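/- Let $k$ be a field of characteristic $5$, and for $i=1,2$ let $V_i$ be a two-dimensional $k$-vector space with a nonzero alternating bilinear form $\langle\cdot|\cdot\rangle$. Let $\mathfrak{sp}(V_i)$ be the Lie algebra of endomorphisms $f$ of $V_i$ with $\langle f(a)|b\rangle=-\langle a|f(b)\rangle$ for all $a,b$, and for $a,b\in V_i$ let $\gamma_{a,b}=\langle a|\cdot\rangle b+\langle b|\cdot\rangle a\in\mathfrak{sp}(V_i)$. Let $$\mathfrak g=(\mathfrak{sp}(V_1)\oplus\mathfrak{sp}(V_2))\oplus(\mathfrak{sp}(V_1)\otimes V_2)\oplus(V_1\otimes\mathfrak{sp}(V_2))\oplus(V_1\otimes V_2),$$ with even part $\mathfrak g_{\bar 0}=(\mathfrak{sp}(V_1)\oplus\mathfrak{sp}(V_2))\oplus(V_1\otimes V_2)$ and odd part $\mathfrak g_{\bar 1}=(\mathfrak{sp}(V_1)\otimes V_2)\oplus(V_1\otimes\mathfrak{sp}(V_2))$. Define a superanticommutative bilinear product on $\mathfrak g$ by the Lie bracket of $\mathfrak{sp}(V_1)\oplus\mathfrak{sp}(V_2)$, its natural action on each of the other three summands ($V_i$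 being the natural and $\mathfrak{sp}(V_i)$ the adjoint module for $\mathfrak{sp}(V_i)$), and $$\begin{aligned} [f\otimes u,g\otimes v]&=\langle u|v\rangle[f,g]+2\operatorname{tr}(fg)\gamma_{u,v},\\ [a\otimes p,b\otimes q]&=-\bigl(2\operatorname{tr}(pq)\gamma_{a,b}+\langle a|b\rangle[p,q]\bigr),\\ [a\otimes u,b\otimes v]&=\langle u|v\rangle\gamma_{a,b}+\langle a|b\rangle\gamma_{u,v},\\ [f\otimes u,a\otimes p]&=f(a)\otimes p(u),\\ [f\otimes u,a\otimes v]&=f(a)\otimes\gamma_{u,v},\\ [a\otimes p,b\otimes v]&=-\gamma_{a,b}\otimes p(v), \end{aligned}$$ for $a,b\in V_1$, $u,v\in V_2$, $f,g\in\mathfrak{sp}(V_1)$, $p,q\in\mathfrak{sp}(V_2)$. Then $\mathfrak g$ is a Lie superalgebra; its even part $\mathfrak g_{\bar 0}$ is isomorphic, as a Lie algebra, to the symplectic Lie algebra $\mathfrak{sp}(V_1\perp V_2)$ of the orthogonal sum of $V_1$ and $V_2$, and to the symplectic Lie algebra $\mathfrak{sp}_4(k)$ of $4\times4$ matrices; and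 $\mathfrak g$ is isomorphic, as a superalgebra, to $\mathfrak{br}(2;5)$. Here $\mathfrak{br}(2;5)$ is the Lie superalgebra over $k$ with Cartan matrix $A=\begin{pmatrix}0&-1\\-2&1\end{pmatrix}$ and both simple roots odd. That is, let $\tilde{\mathfrak g}(A)$ be the Lie superalgebra with odd generators $e_1,e_2,f_1,f_2$, even generators $h_1,h_2$ and relations $[h_i,h_j]=0$, $[e_i,f_j]=\delta_{ij}h_i$, $[h_i,e_j]=A_{ij}e_j$, $[h_i,f_j]=-A_{ij}f_j$, graded by $\mathbb Z^2$ with $\deg e_i=-\deg f_i=\epsilon_i$ and $\deg h_i=0$; then $\mathfrak{br}(2;5)$ is the quotient of $\tilde{\mathfrak g}(A)$ by the sum of all its $\mathbb Z^2$-graded ideals that meet $\operatorname{span}\{h_1,h_2\}$ trivially. -/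

import Mathlib

open scoped TensorProduct

-- the commutator bracket on associative rings (endomorphisms, matrices)
attribute [local instance 100] LieRing.ofAssociativeRing

noncomputable section

/-! ## Superalgebras given by a bilinear product and a parity decomposition -/

section Super

variable {k : Type*} [Field k] {L : Type*} [AddCommGroup L] [Module k L]

/-- The sign `(-1)^{ij}` for parities `i, j`. -/
def superSign (k : Type*) [Field k] (i j : ZMod 2) : k := (-1) ^ (i.val * j.val)

/-- `L = P 0 ⊕ P 1` is a Lie superalgebra under the bilinear product `br`: the product is even,
superanticommutative, and satisfies the super Jacobi identity. (This is the standard definition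
over fields of characteristic different from `2` and `3`, the only ones considered below.) -/
structure IsLieSuperalgebra (P : ZMod 2 → Submodule k L) (br : L →ₗ[k] L →ₗ[k] L) : Prop where
  isInternal : DirectSum.IsInternal P
  bracket_mem : ∀ (i j : ZMod 2) (x y : L), x ∈ P i → y ∈ P j → br x y ∈ P (i + j)
  superAnticomm : ∀ (i j : ZMod 2) (x y : L), x ∈ P i → y ∈ P j →
    br x y = -(superSign k i j • br y x)
  superJacobi : ∀ (i j : ZMod 2) (x y z : L), x ∈ P i → y ∈ P j →
    br x (br y z) = br (br x y) z + superSign k i j • br y (br x z)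

/-- Isomorphism of superalgebras: a linear bijection that respects parity and products. -/
def SuperalgebraIso {M : Type*} [AddCommGroup M] [Module k M]
    (P : ZMod 2 → Submodule k L) (br : L →ₗ[k] L →ₗ[k] L)
    (Q : ZMod 2 → Submodule k M) (br' : M →ₗ[k] M →ₗ[k] M) : Prop :=
  ∃ φ : L ≃ₗ[k] M, (∀ i, (P i).map φ.toLinearMap = Q i) ∧ ∀ x y, φ (br x y) = br' (φ x) (φ y)

/-- Two-sided ideals for a bilinear product. -/
def IsTwoSidedIdeal (br : L →ₗ[k] L →ₗ[k] L) (I : Submodule k L) : Prop :=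
  ∀ x, ∀ y ∈ I, br x y ∈ I ∧ br y x ∈ I

/-- The product induced on the quotient by a two-sided ideal. -/
def quotientBracket (br : L →ₗ[k] L →ₗ[k] L) (I : Submodule k L) (hI : IsTwoSidedIdeal br I) :
    (L ⧸ I) →ₗ[k] (L ⧸ I) →ₗ[k] (L ⧸ I) :=
  I.liftQ
    { toFun := fun x => I.mapQ I (br x) fun y hy => (hI x y hy).1
      map_add' := fun x y => by ext z; simp
      map_smul' := fun c x => by ext z; simp }
    (fun x hx => by
      rw [LinearMap.mem_ker]
      ext z
      simpa using (hI z x hx).2)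

theorem quotientBracket_mk (br : L →ₗ[k] L →ₗ[k] L) (I : Submodule k L)
    (hI : IsTwoSidedIdeal br I) (x y : L) :
    quotientBracket br I hI (I.mkQ x) (I.mkQ y) = I.mkQ (br x y) := rfl

theorem isTwoSidedIdeal_sInf (br : L →ₗ[k] L →ₗ[k] L) (S : Set (Submodule k L))
    (hS : ∀ I ∈ S, IsTwoSidedIdeal br I) : IsTwoSidedIdeal br (sInf S) := by
  intro x y hy
  rw [Submodule.mem_sInf] at hy
  simp only [Submodule.mem_sInf]
  exact ⟨fun I hI => (hS I hI x y (hy I hI)).1, fun I hI => (hS I hI x y (hy I hI)).2⟩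

theorem isTwoSidedIdeal_sSup (br : L →ₗ[k] L →ₗ[k] L) (S : Set (Submodule k L))
    (hS : ∀ I ∈ S, IsTwoSidedIdeal br I) : IsTwoSidedIdeal br (sSup S) := by
  have h1 : ∀ x, sSup S ≤ (sSup S).comap (br x) := fun x => sSup_le fun I hI y hy =>
    (le_sSup hI : I ≤ sSup S) (hS I hI x y hy).1
  have h2 : ∀ x, sSup S ≤ (sSup S).comap (br.flip x) := fun x => sSup_le fun I hI y hy =>
    (le_sSup hI : I ≤ sSup S) (hS I hI x y hy).2
  exact fun x y hy => ⟨h1 x hy, h2 x hy⟩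

/-- The two-sided ideal generated by a set. -/
def idealSpan (br : L →ₗ[k] L →ₗ[k] L) (s : Set L) : Submodule k L :=
  sInf {I | IsTwoSidedIdeal br I ∧ s ⊆ I}

theorem isTwoSidedIdeal_idealSpan (br : L →ₗ[k] L →ₗ[k] L) (s : Set L) :
    IsTwoSidedIdeal br (idealSpan br s) :=
  isTwoSidedIdeal_sInf br _ fun _ hI => hI.1

end Super

/-! ## The contragredient Lie superalgebra of a Cartan matrix

For an invertible matrix `A` of size `n` with entries in `k` and parities `I_1, …, I_n`, the Lie
superalgebra `𝔤̃(A, I)` is presented by generators `e_i, f_i` (of parity `I_i`) and `h_i` (even), and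
relations `[h_i, h_j] = 0`, `[e_i, f_j] = δ_ij h_i`, `[h_i, e_j] = A_ij e_j`,
`[h_i, f_j] = -A_ij f_j`. It is `ℤⁿ`-graded with `deg e_i = ε_i = -deg f_i`, `deg h_i = 0`. The Lie
superalgebra `𝔤(A, I)` with Cartan matrix `A` is the quotient of `𝔤̃(A, I)` by its largest
`ℤⁿ`-graded ideal that meets `𝔥 = span {h_1, …, h_n}` trivially. (As `A` is invertible, `𝔥` needs
no further elements.) -/

namespace Contragredient

/-- The Chevalley generators. -/
inductive Gen (n : ℕ) : Type
  | e (i : Fin n) : Gen n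
  | f (i : Fin n) : Gen n
  | h (i : Fin n) : Gen n

/-- Degree in `ℤⁿ` of a generator. -/
def genDeg {n : ℕ} : Gen n → (Fin n → ℤ)
  | .e i => Pi.single i 1
  | .f i => -Pi.single i 1
  | .h _ => 0

/-- Parity of a generator. -/
def genParity {n : ℕ} (I : Fin n → ZMod 2) : Gen n → ZMod 2
  | .e i => I i
  | .f i => I i
  | .h _ => 0

/-- Degree in `ℤⁿ` of a nonassociative monomial. -/
def deg {n : ℕ} : FreeMagma (Gen n) → (Fin n → ℤ)
  | .of x => genDeg x
  | .mul a b => deg a + deg b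

/-- Parity of a nonassociative monomial. -/
def parity {n : ℕ} (I : Fin n → ZMod 2) : FreeMagma (Gen n) → ZMod 2
  | .of x => genParity I x
  | .mul a b => parity I a + parity I b

variable (k : Type*) [Field k] {n : ℕ} (A : Matrix (Fin n) (Fin n) k) (I : Fin n → ZMod 2)

/-- The free nonassociative algebra on the Chevalley generators. -/
abbrev FreeAlg (n : ℕ) : Type _ := FreeNonUnitalNonAssocAlgebra k (Gen n)

/-- Its product, as a bilinear map. -/
abbrev freeMul (n : ℕ) : FreeAlg k n →ₗ[k] FreeAlg k n →ₗ[k] FreeAlg k n :=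
  LinearMap.mul k (FreeAlg k n)

/-- A nonassociative monomial, as an element of the free algebra. -/
def mon (m : FreeMagma (Gen n)) : FreeAlg k n := MonoidAlgebra.single m 1

/-- A generator, as an element of the free algebra. -/
def gen (x : Gen n) : FreeAlg k n := FreeNonUnitalNonAssocAlgebra.of k x

/-- The defining relations: superanticommutativity and super Jacobi (on monomials), and the
Chevalley relations. -/
inductive Rel : FreeAlg k n → Prop
  | superAnticomm (a b : FreeMagma (Gen n)) :
      Rel (mon k a * mon k b + superSign k (parity I a) (parity I b) • (mon k b * mon k a))
  | superJacobi (a b c : FreeMagma (Gen n)) :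
      Rel (mon k a * (mon k b * mon k c) - (mon k a * mon k b) * mon k c
        - superSign k (parity I a) (parity I b) • (mon k b * (mon k a * mon k c)))
  | h_h (i j : Fin n) : Rel (gen k (.h i) * gen k (.h j))
  | e_f_same (i : Fin n) : Rel (gen k (.e i) * gen k (.f i) - gen k (.h i))
  | e_f_diff (i j : Fin n) (hij : i ≠ j) : Rel (gen k (.e i) * gen k (.f j))
  | h_e (i j : Fin n) : Rel (gen k (.h i) * gen k (.e j) - A i j • gen k (.e j))
  | h_f (i j : Fin n) : Rel (gen k (.h i) * gen k (.f j) + A i j • gen k (.f j))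

/-- The ideal generated by the relations. -/
def relIdeal : Submodule k (FreeAlg k n) := idealSpan (freeMul k n) {x | Rel k A I x}

/-- The Lie superalgebra `𝔤̃(A, I)`. -/
abbrev Tilde : Type _ := FreeAlg k n ⧸ relIdeal k A I

/-- The product of `𝔤̃(A, I)`. -/
def tildeBracket : Tilde k A I →ₗ[k] Tilde k A I →ₗ[k] Tilde k A I :=
  quotientBracket (freeMul k n) (relIdeal k A I) (isTwoSidedIdeal_idealSpan _ _)

/-- The image in `𝔤̃(A, I)` of an element of the free algebra. -/
abbrev toTilde : FreeAlg k n →ₗ[k] Tilde k A I := (relIdeal k A I).mkQ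

/-- The homogeneous component of degree `d ∈ ℤⁿ` of `𝔤̃(A, I)`. -/
def tildeGrading (d : Fin n → ℤ) : Submodule k (Tilde k A I) :=
  Submodule.span k {x | ∃ m : FreeMagma (Gen n), deg m = d ∧ x = toTilde k A I (mon k m)}

/-- The even (`p = 0`) and odd (`p = 1`) parts of `𝔤̃(A, I)`. -/
def tildeParity (p : ZMod 2) : Submodule k (Tilde k A I) :=
  Submodule.span k {x | ∃ m : FreeMagma (Gen n), parity I m = p ∧ x = toTilde k A I (mon k m)}

/-- The subspace `𝔥` of `𝔤̃(A, I)` spanned by the `h_i`. -/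
def tildeCartan : Submodule k (Tilde k A I) :=
  Submodule.span k (Set.range fun i : Fin n => toTilde k A I (gen k (.h i)))

/-- `ℤⁿ`-graded two-sided ideals of `𝔤̃(A, I)` meeting `𝔥` trivially. -/
def IsGradedIdealAvoidingCartan (J : Submodule k (Tilde k A I)) : Prop :=
  IsTwoSidedIdeal (tildeBracket k A I) J ∧ J = ⨆ d, J ⊓ tildeGrading k A I d ∧
    J ⊓ tildeCartan k A I = ⊥

/-- The sum of all `ℤⁿ`-graded ideals of `𝔤̃(A, I)` meeting `𝔥` trivially, which is the largest
such ideal. -/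
def radical : Submodule k (Tilde k A I) :=
  sSup {J | IsGradedIdealAvoidingCartan k A I J}

theorem isTwoSidedIdeal_radical : IsTwoSidedIdeal (tildeBracket k A I) (radical k A I) :=
  isTwoSidedIdeal_sSup _ _ fun _ hJ => hJ.1

/-- The Lie superalgebra `𝔤(A, I)` with Cartan matrix `A` and parities `I`. -/
abbrev Alg : Type _ := Tilde k A I ⧸ radical k A I

/-- The product of `𝔤(A, I)`. -/
def bracket : Alg k A I →ₗ[k] Alg k A I →ₗ[k] Alg k A I :=
  quotientBracket (tildeBracket k A I) (radical k A I) (isTwoSidedIdeal_radical k A I)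

/-- The even and odd parts of `𝔤(A, I)`. -/
def algParity (p : ZMod 2) : Submodule k (Alg k A I) :=
  (tildeParity k A I p).map (radical k A I).mkQ

end Contragredient

/-! ## The Lie superalgebra `𝔟𝔯(2;5)` -/

/-- The Cartan matrix of `𝔟𝔯(2;5)`. -/
def br25Matrix (k : Type*) [Field k] : Matrix (Fin 2) (Fin 2) k := !![0, -1; -2, 1]

/-- Both simple roots of `𝔟𝔯(2;5)` are odd. -/
def br25SimpleParity : Fin 2 → ZMod 2 := fun _ => 1

/-- The superspace underlying `𝔟𝔯(2;5)` (for `k` of characteristic `5`). -/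
abbrev Br25 (k : Type*) [Field k] : Type _ :=
  Contragredient.Alg k (br25Matrix k) br25SimpleParity

/-- The product of `𝔟𝔯(2;5)`. -/
def br25Bracket (k : Type*) [Field k] : Br25 k →ₗ[k] Br25 k →ₗ[k] Br25 k :=
  Contragredient.bracket k (br25Matrix k) br25SimpleParity

/-- The even and odd parts of `𝔟𝔯(2;5)`. -/
def br25Parity (k : Type*) [Field k] (p : ZMod 2) : Submodule k (Br25 k) :=
  Contragredient.algParity k (br25Matrix k) br25SimpleParity p

/-! ## The model built from two symplectic planes -/

namespace Model

section OnePlane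

variable {k : Type*} [Field k] {V : Type*} [AddCommGroup V] [Module k V]

/-- `𝔰𝔭(V)`: the endomorphisms `f` with `⟨f a | b⟩ = -⟨a | f b⟩`. -/
abbrev Sp (B : LinearMap.BilinForm k V) : Type _ := skewAdjointLieSubalgebra B

/-- The natural action `f ↦ (a ↦ f a)`. -/
def act (B : LinearMap.BilinForm k V) : Sp B →ₗ[k] V →ₗ[k] V :=
  (skewAdjointLieSubalgebra B).toSubmodule.subtype

/-- The Lie bracket `(f, g) ↦ [f, g]` of `𝔰𝔭(V)`, i.e. its adjoint action. -/
def ad (B : LinearMap.BilinForm k V) : Sp B →ₗ[k] Sp B →ₗ[k] Sp B :=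
  (LieAlgebra.ad k (Sp B)).toLinearMap

/-- The bilinear map `(f, g) ↦ tr (f g)` on `𝔰𝔭(V)`. -/
def trForm (B : LinearMap.BilinForm k V) : Sp B →ₗ[k] Sp B →ₗ[k] k :=
  LinearMap.compl₁₂ ((LinearMap.mul k (Module.End k V)).compr₂ (LinearMap.trace k V))
    (act B) (act B)

/-- The bilinear map `(a, b) ↦ γ_{a,b} = ⟨a | ·⟩ b + ⟨b | ·⟩ a` with values in `𝔰𝔭(V)`. -/
def gamma (B : LinearMap.BilinForm k V) (hB : B.IsAlt) : V →ₗ[k] V →ₗ[k] Sp B :=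
  LinearMap.mk₂ k
    (fun a b => ⟨(B a).smulRight b + (B b).smulRight a, by
      refine (LinearMap.mem_skewAdjointSubmodule _).mpr fun x y => ?_
      have h := fun x y : V => (LinearMap.IsAlt.neg hB y x).symm
      simp only [LinearMap.add_apply, LinearMap.smul_apply, LinearMap.smulRight_apply, map_add, map_smul,
        Pi.neg_apply, smul_eq_mul, neg_add_rev, map_neg]
      rw [h x b, h x a]
      ring⟩)
    (fun a a' b => by ext c; simp [add_smul]; abel)
    (fun r a b => by ext c; simp [smul_smul, mul_comm])
    (fun a b b' => by ext c; simp [add_smul]; abel)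
    (fun r a b => by ext c; simp [smul_smul, mul_comm])

end OnePlane

section TwoPlanes

variable {k : Type*} [Field k] {V₁ V₂ : Type*} [AddCommGroup V₁] [Module k V₁]
  [AddCommGroup V₂] [Module k V₂]
  (B₁ : LinearMap.BilinForm k V₁) (B₂ : LinearMap.BilinForm k V₂)

/-- The vector space
`(𝔰𝔭(V₁) ⊕ 𝔰𝔭(V₂)) ⊕ (𝔰𝔭(V₁) ⊗ V₂) ⊕ (V₁ ⊗ 𝔰𝔭(V₂)) ⊕ (V₁ ⊗ V₂)`, the summands being those of
degree `(0,0)`, `(1,0)`, `(0,1)`, `(1,1)`, in this order. -/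
abbrev Space : Type _ :=
  (Sp B₁ × Sp B₂) × (Sp B₁ ⊗[k] V₂) × (V₁ ⊗[k] Sp B₂) × (V₁ ⊗[k] V₂)

/-- The even part (degrees `(0,0)` and `(1,1)`) and the odd part (degrees `(1,0)` and `(0,1)`). -/
def parity (p : ZMod 2) : Submodule k (Space B₁ B₂) :=
  if p = 0 then (⊤ : Submodule k (Sp B₁ × Sp B₂)).prod (Submodule.prod ⊥ (Submodule.prod ⊥ ⊤))
  else (⊥ : Submodule k (Sp B₁ × Sp B₂)).prod (Submodule.prod ⊤ (Submodule.prod ⊤ ⊥))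

/-- The action of `𝔰𝔭(V₁) ⊕ 𝔰𝔭(V₂)` on a tensor product `M₁ ⊗ M₂`, where `𝔰𝔭(V_i)` acts on `M_i`:
`(f, p) · (x ⊗ y) = (f · x) ⊗ y + x ⊗ (p · y)`. -/
def tensorAct {M₁ M₂ : Type*} [AddCommGroup M₁] [Module k M₁] [AddCommGroup M₂] [Module k M₂]
    (ρ₁ : Sp B₁ →ₗ[k] M₁ →ₗ[k] M₁) (ρ₂ : Sp B₂ →ₗ[k] M₂ →ₗ[k] M₂) :
    (Sp B₁ × Sp B₂) →ₗ[k] (M₁ ⊗[k] M₂) →ₗ[k] (M₁ ⊗[k] M₂) :=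
  LinearMap.coprod (LinearMap.rTensorHom M₂ ∘ₗ ρ₁) (LinearMap.lTensorHom M₁ ∘ₗ ρ₂)

variable {B₁ B₂}

/-- `(x ⊗ y, x' ⊗ y') ↦ β(y, y') φ(x, x')`. -/
def tensorLeft {M N M' N' E : Type*} [AddCommGroup M] [Module k M] [AddCommGroup N] [Module k N]
    [AddCommGroup M'] [Module k M'] [AddCommGroup N'] [Module k N'] [AddCommGroup E] [Module k E]
    (φ : M →ₗ[k] M' →ₗ[k] E) (β : N →ₗ[k] N' →ₗ[k] k) :
    (M ⊗[k] N) →ₗ[k] (M' ⊗[k] N') →ₗ[k] E :=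
  (TensorProduct.map₂ φ β).compr₂ (TensorProduct.rid k E).toLinearMap

/-- `(x ⊗ y, x' ⊗ y') ↦ β(x, x') φ(y, y')`. -/
def tensorRight {M N M' N' E : Type*} [AddCommGroup M] [Module k M] [AddCommGroup N] [Module k N]
    [AddCommGroup M'] [Module k M'] [AddCommGroup N'] [Module k N'] [AddCommGroup E] [Module k E]
    (β : M →ₗ[k] M' →ₗ[k] k) (φ : N →ₗ[k] N' →ₗ[k] E) :
    (M ⊗[k] N) →ₗ[k] (M' ⊗[k] N') →ₗ[k] E :=
  (TensorProduct.map₂ β φ).compr₂ (TensorProduct.lid k E).toLinearMap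

variable (h₁ : B₁.IsAlt) (h₂ : B₂.IsAlt)

/-- `[f ⊗ u, g ⊗ v] = ⟨u | v⟩ [f, g] + 2 tr(f g) γ_{u,v}`. -/
def mul1010 : (Sp B₁ ⊗[k] V₂) →ₗ[k] (Sp B₁ ⊗[k] V₂) →ₗ[k] (Sp B₁ × Sp B₂) :=
  (tensorLeft (ad B₁) B₂).compr₂ (LinearMap.inl k _ _) +
    (2 : k) • (tensorRight (trForm B₁) (gamma B₂ h₂)).compr₂ (LinearMap.inr k _ _)

/-- `[a ⊗ p, b ⊗ q] = -(2 tr(p q) γ_{a,b} + ⟨a | b⟩ [p, q])`. -/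
def mul0101 : (V₁ ⊗[k] Sp B₂) →ₗ[k] (V₁ ⊗[k] Sp B₂) →ₗ[k] (Sp B₁ × Sp B₂) :=
  -((2 : k) • (tensorLeft (gamma B₁ h₁) (trForm B₂)).compr₂ (LinearMap.inl k _ _) +
    (tensorRight B₁ (ad B₂)).compr₂ (LinearMap.inr k _ _))

/-- `[a ⊗ u, b ⊗ v] = ⟨u | v⟩ γ_{a,b} + ⟨a | b⟩ γ_{u,v}`. -/
def mul1111 : (V₁ ⊗[k] V₂) →ₗ[k] (V₁ ⊗[k] V₂) →ₗ[k] (Sp B₁ × Sp B₂) :=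
  (tensorLeft (gamma B₁ h₁) B₂).compr₂ (LinearMap.inl k _ _) +
    (tensorRight B₁ (gamma B₂ h₂)).compr₂ (LinearMap.inr k _ _)

variable (B₁ B₂) in
/-- `[f ⊗ u, a ⊗ p] = f(a) ⊗ p(u)`. -/
def mul1001 : (Sp B₁ ⊗[k] V₂) →ₗ[k] (V₁ ⊗[k] Sp B₂) →ₗ[k] (V₁ ⊗[k] V₂) :=
  TensorProduct.map₂ (act B₁) (act B₂).flip

variable (B₁) in
/-- `[f ⊗ u, a ⊗ v] = f(a) ⊗ γ_{u,v}`. -/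
def mul1011 : (Sp B₁ ⊗[k] V₂) →ₗ[k] (V₁ ⊗[k] V₂) →ₗ[k] (V₁ ⊗[k] Sp B₂) :=
  TensorProduct.map₂ (act B₁) (gamma B₂ h₂)

variable (B₂) in
/-- `[a ⊗ p, b ⊗ v] = -γ_{a,b} ⊗ p(v)`. -/
def mul0111 : (V₁ ⊗[k] Sp B₂) →ₗ[k] (V₁ ⊗[k] V₂) →ₗ[k] (Sp B₁ ⊗[k] V₂) :=
  -TensorProduct.map₂ (gamma B₁ h₁) (act B₂)

/-- The superanticommutative product on the model. Writing an element as `(s, x, y, z)` with `s` of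
degree `(0,0)`, `x` of degree `(1,0)`, `y` of degree `(0,1)` and `z` of degree `(1,1)`: degree
`(0,0)` has its natural Lie bracket and acts naturally on the other components, the remaining
products are the six above, and the products in the opposite order are fixed by
superanticommutativity (a plus sign when both factors are odd, a minus sign otherwise). -/
def bracket : Space B₁ B₂ →ₗ[k] Space B₁ B₂ →ₗ[k] Space B₁ B₂ :=
  LinearMap.mk₂ k
    (fun X Y =>
      ((ad B₁ X.1.1 Y.1.1, ad B₂ X.1.2 Y.1.2)
          + mul1010 h₂ X.2.1 Y.2.1 + mul0101 h₁ X.2.2.1 Y.2.2.1 + mul1111 h₁ h₂ X.2.2.2 Y.2.2.2,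
        tensorAct B₁ B₂ (ad B₁) (act B₂) X.1 Y.2.1 - tensorAct B₁ B₂ (ad B₁) (act B₂) Y.1 X.2.1
          + mul0111 B₂ h₁ X.2.2.1 Y.2.2.2 - mul0111 B₂ h₁ Y.2.2.1 X.2.2.2,
        tensorAct B₁ B₂ (act B₁) (ad B₂) X.1 Y.2.2.1
          - tensorAct B₁ B₂ (act B₁) (ad B₂) Y.1 X.2.2.1
          + mul1011 B₁ h₂ X.2.1 Y.2.2.2 - mul1011 B₁ h₂ Y.2.1 X.2.2.2,
        tensorAct B₁ B₂ (act B₁) (act B₂) X.1 Y.2.2.2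
          - tensorAct B₁ B₂ (act B₁) (act B₂) Y.1 X.2.2.2
          + mul1001 B₁ B₂ X.2.1 Y.2.2.1 + mul1001 B₁ B₂ Y.2.1 X.2.2.1))
    (fun X X' Y => by
      ext : 1
      · ext : 1 <;> simp <;> abel
      · ext : 1
        · simp; abel
        · ext : 1 <;> simp <;> abel)
    (fun r X Y => by
      ext : 1
      · ext : 1 <;> simp
      · ext : 1
        · simp [smul_sub]
        · ext : 1 <;> simp [smul_sub])
    (fun X Y Y' => by
      ext : 1
      · ext : 1 <;> simp <;> abel
      · ext : 1
        · simp; abel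
        · ext : 1 <;> simp <;> abel)
    (fun r X Y => by
      ext : 1
      · ext : 1 <;> simp
      · ext : 1
        · simp [smul_sub]
        · ext : 1 <;> simp [smul_sub])

variable (B₁ B₂)

/-- The form of the orthogonal sum `V₁ ⊥ V₂`:
`⟨(a, u) | (b, v)⟩ = ⟨a | b⟩ + ⟨u | v⟩`. -/
def orthSum : LinearMap.BilinForm k (V₁ × V₂) :=
  B₁.compl₁₂ (LinearMap.fst k V₁ V₂) (LinearMap.fst k V₁ V₂) +
    B₂.compl₁₂ (LinearMap.snd k V₁ V₂) (LinearMap.snd k V₁ V₂)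

end TwoPlanes

end Model

end

/-! The model is governed by one integer table. A nonzero alternating form on a plane admits a basis
with ⟨v₀|v₁⟩ = 1, and 𝔰𝔭(V) then has the usual basis E, H, F. The products of the resulting 22
homogeneous basis vectors have integer coefficients that do not depend on the data
(`bracket_spaceBasis`), so the identities needed are finite checks modulo 5.

Jacobi identity: it holds with x in the first slot exactly when left multiplication by x is a
superderivation, and such homogeneous x are closed under the product (`bracket_mem_superDer`). Four
root vectors e₁, e₂, f₁, f₂ generate the model (`idx_induction`), so only triples that start with
one of them are computed.

Comparison with 𝔟𝔯(2;5): these four vectors, with h₁ and h₂, satisfy the Chevalley relations, which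
gives a graded surjection π from 𝔤̃(A) onto the model. Its kernel is the radical (`radical_eq_ker`).
On the one hand, ker π is graded and meets 𝔥 trivially, because the h_i stay independent in the
model. On the other hand, the triangular decomposition shows that 𝔤̃(A) has only 𝔥 in degree 0
(`tildeGrading_zero_le`), so a graded ideal avoiding 𝔥 is carried by π to a graded ideal of the
model without degree 0 part. Such an ideal vanishes (`eq_bot_of_isTwoSidedIdeal`): root spaces are
lines, and each root vector has a nonzero product with one of opposite degree.

Even part: in block form an element of 𝔰𝔭(V₁ ⊥ V₂) has diagonal blocks in 𝔰𝔭(V₁) and 𝔰𝔭(V₂), and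
either off-diagonal block determines the other. The map a ⊗ u ↦ γ_{a,u} identifies V₁ ⊗ V₂ with the
off-diagonal part. A union of symplectic bases, suitably ordered, then has Gram matrix J, which
yields 𝔰𝔭₄. -/

noncomputable section

/-! ### Triangular decomposition of 𝔤̃(A, I) -/

namespace Contragredient

section Tilde

variable (k : Type*) [Field k] {n : ℕ} (A : Matrix (Fin n) (Fin n) k) (I : Fin n → ZMod 2)

theorem mon_mul (a b : FreeMagma (Gen n)) : mon k (a * b) = mon k a * mon k b := by
  simp [mon, MonoidAlgebra.single_mul_single]

theorem mon_of (x : Gen n) : mon k (FreeMagma.of x) = gen k x := rfl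

theorem span_range_mon : Submodule.span k (Set.range (mon k (n := n))) = ⊤ := by
  refine eq_top_iff.2 fun x _ => ?_
  induction x using MonoidAlgebra.induction_linear with
  | zero => exact zero_mem _
  | add x y hx hy => exact add_mem (hx trivial) (hy trivial)
  | single m c =>
    have : (MonoidAlgebra.single m c : FreeAlg k n) = c • mon k m := by
      simp [mon]
    rw [this]
    exact Submodule.smul_mem _ _ (Submodule.subset_span ⟨m, rfl⟩)

/-- The image in `𝔤̃(A, I)` of a nonassociative monomial. -/
def tildeMon (m : FreeMagma (Gen n)) : Tilde k A I := toTilde k A I (mon k m)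

theorem span_range_tildeMon : Submodule.span k (Set.range (tildeMon k A I)) = ⊤ := by
  have h := congrArg (Submodule.map (toTilde k A I)) (span_range_mon k (n := n))
  rw [Submodule.map_span, ← Set.range_comp, Submodule.map_top, Submodule.range_mkQ] at h
  exact h

theorem tildeMon_mul (a b : FreeMagma (Gen n)) :
    tildeMon k A I (a * b) = tildeBracket k A I (tildeMon k A I a) (tildeMon k A I b) := by
  rw [tildeMon, mon_mul]; rfl

variable {k A I} in
theorem toTilde_eq_zero_of_rel {x : FreeAlg k n} (hx : Rel k A I x) : toTilde k A I x = 0 := by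
  rw [toTilde, Submodule.mkQ_apply, Submodule.Quotient.mk_eq_zero, relIdeal, idealSpan,
    Submodule.mem_sInf]
  exact fun J hJ => hJ.2 hx

theorem tildeBracket_anticomm (a b : FreeMagma (Gen n)) :
    tildeBracket k A I (tildeMon k A I a) (tildeMon k A I b) =
      -(superSign k (parity I a) (parity I b) •
        tildeBracket k A I (tildeMon k A I b) (tildeMon k A I a)) := by
  have h := toTilde_eq_zero_of_rel (A := A) (Rel.superAnticomm (k := k) (I := I) a b)
  rw [map_add, map_smul] at h
  exact eq_neg_of_add_eq_zero_left h

/-- The relation is imposed on monomials. Linearity frees the last argument, whose parity does not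
enter the sign; `a` and `b` stay monomials so that they have a parity. -/
theorem tildeBracket_jacobi (a b : FreeMagma (Gen n)) (z : Tilde k A I) :
    tildeBracket k A I (tildeMon k A I a) (tildeBracket k A I (tildeMon k A I b) z) =
      tildeBracket k A I (tildeBracket k A I (tildeMon k A I a) (tildeMon k A I b)) z +
        superSign k (parity I a) (parity I b) •
          tildeBracket k A I (tildeMon k A I b) (tildeBracket k A I (tildeMon k A I a) z) := by
  have hz : z ∈ Submodule.span k (Set.range (tildeMon k A I)) := by
    rw [span_range_tildeMon]; trivial
  induction hz using Submodule.span_induction with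
  | mem x hx =>
    obtain ⟨c, rfl⟩ := hx
    have h := toTilde_eq_zero_of_rel (A := A) (Rel.superJacobi (k := k) (I := I) a b c)
    rw [map_sub, map_sub, map_smul, sub_sub, sub_eq_zero] at h
    exact h
  | zero => simp
  | add x y _ _ hx hy => simp only [map_add, hx, hy, smul_add]; abel
  | smul c x _ hx => simp only [map_smul, hx, smul_add, smul_comm c]

end Tilde

section Triangular

variable {k : Type*} [Field k] {n : ℕ} {A : Matrix (Fin n) (Fin n) k} {I : Fin n → ZMod 2}

/-- The raising (`true`) and lowering (`false`) Chevalley generators. -/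
def chevalley (s : Bool) (i : Fin n) : FreeMagma (Gen n) :=
  FreeMagma.of (if s then .e i else .f i)

/-- Right-normed words in the raising, respectively lowering, generators. -/
inductive IsWord (s : Bool) : FreeMagma (Gen n) → Prop
  | of (i : Fin n) : IsWord s (chevalley s i)
  | cons (i : Fin n) (m : FreeMagma (Gen n)) : IsWord s m → IsWord s (chevalley s i * m)

theorem deg_mul (a b : FreeMagma (Gen n)) : deg (a * b) = deg a + deg b := rfl

theorem deg_chevalley (s : Bool) (i : Fin n) :
    deg (chevalley s i) = if s then Pi.single i 1 else -Pi.single i 1 := by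
  cases s <;> rfl

/-- The coordinate sum of the degree counts the letters, with the sign given by `s`. -/
theorem IsWord.deg_ne_zero {s : Bool} {m : FreeMagma (Gen n)} (hm : IsWord s m) : deg m ≠ 0 := by
  have key : 0 < (if s then (1 : ℤ) else -1) * ∑ i, deg m i := by
    induction hm with
    | of i => cases s <;> simp [deg_chevalley]
    | cons i m _ ih =>
      rw [deg_mul]
      cases s <;> simp [deg_chevalley, Finset.sum_add_distrib] at ih ⊢ <;> omega
  intro h
  simp [h] at key

variable (k A I) in
/-- The span of the words of degree `d`. -/
def wordSpan (s : Bool) (d : Fin n → ℤ) : Submodule k (Tilde k A I) :=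
  Submodule.span k {x | ∃ m, IsWord s m ∧ deg m = d ∧ x = tildeMon k A I m}

variable (k A I) in
/-- The degree `d` part of `𝔥`. -/
def cartanSpan (d : Fin n → ℤ) : Submodule k (Tilde k A I) :=
  Submodule.span k {x | d = 0 ∧ ∃ i, x = tildeMon k A I (.of (.h i))}

variable (k A I) in
/-- The degree `d` part of `𝔫⁺ + 𝔥 + 𝔫⁻`. -/
def triangular (d : Fin n → ℤ) : Submodule k (Tilde k A I) :=
  wordSpan k A I true d ⊔ wordSpan k A I false d ⊔ cartanSpan k A I d

theorem mem_wordSpan {s : Bool} {m : FreeMagma (Gen n)} (hm : IsWord s m) :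
    tildeMon k A I m ∈ wordSpan k A I s (deg m) :=
  Submodule.subset_span ⟨m, hm, rfl, rfl⟩

theorem wordSpan_le_triangular (s : Bool) (d : Fin n → ℤ) :
    wordSpan k A I s d ≤ triangular k A I d := by
  cases s
  · exact le_sup_right.trans le_sup_left
  · exact le_sup_left.trans le_sup_left

theorem cartanSpan_le_triangular (d : Fin n → ℤ) :
    cartanSpan k A I d ≤ triangular k A I d := le_sup_right

/-- A linear map that sends the spanning elements of degree `d` to a submodule sends everything of
degree `d` there. -/
theorem map_mem_of_mem_triangular {d : Fin n → ℤ} {M : Submodule k (Tilde k A I)}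
    (D : Tilde k A I →ₗ[k] Tilde k A I)
    (hw : ∀ s m, IsWord s m → deg m = d → D (tildeMon k A I m) ∈ M)
    (hh : d = 0 → ∀ i, D (tildeMon k A I (.of (.h i))) ∈ M) {x : Tilde k A I}
    (hx : x ∈ triangular k A I d) : D x ∈ M := by
  revert x
  change _ ≤ M.comap D
  refine sup_le (sup_le ?_ ?_) ?_ <;> refine Submodule.span_le.2 ?_
  · rintro _ ⟨m, hm, hd, rfl⟩; exact hw _ m hm hd
  · rintro _ ⟨m, hm, hd, rfl⟩; exact hw _ m hm hd
  · rintro _ ⟨hd, i, rfl⟩; exact hh hd i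

theorem exists_bracket_h_chevalley (s : Bool) (i j : Fin n) :
    ∃ c : k, tildeBracket k A I (tildeMon k A I (.of (.h i))) (tildeMon k A I (chevalley s j)) =
      c • tildeMon k A I (chevalley s j) := by
  cases s
  · refine ⟨-A i j, ?_⟩
    have h := toTilde_eq_zero_of_rel (I := I) (Rel.h_f (k := k) (A := A) i j)
    rw [map_add, map_smul] at h
    rw [neg_smul]
    exact eq_neg_of_add_eq_zero_left h
  · refine ⟨A i j, ?_⟩
    have h := toTilde_eq_zero_of_rel (I := I) (Rel.h_e (k := k) (A := A) i j)
    rw [map_sub, map_smul] at h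
    exact sub_eq_zero.1 h

theorem exists_bracket_chevalley_h (s : Bool) (i j : Fin n) :
    ∃ c : k, tildeBracket k A I (tildeMon k A I (chevalley s j)) (tildeMon k A I (.of (.h i))) =
      c • tildeMon k A I (chevalley s j) := by
  obtain ⟨c, hc⟩ := exists_bracket_h_chevalley (k := k) (A := A) (I := I) s i j
  rw [tildeBracket_anticomm, hc, smul_smul, ← neg_smul]
  exact ⟨_, rfl⟩

theorem bracket_h_h (i j : Fin n) :
    tildeBracket k A I (tildeMon k A I (.of (.h i))) (tildeMon k A I (.of (.h j))) = 0 :=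
  toTilde_eq_zero_of_rel (Rel.h_h i j)

theorem exists_bracket_e_f (i j : Fin n) :
    ∃ c : k, (i ≠ j → c = 0) ∧
      tildeBracket k A I (tildeMon k A I (chevalley true i)) (tildeMon k A I (chevalley false j)) =
        c • tildeMon k A I (.of (.h i)) := by
  by_cases hij : i = j
  · subst hij
    refine ⟨1, fun h => absurd rfl h, ?_⟩
    have h := toTilde_eq_zero_of_rel (I := I) (Rel.e_f_same (k := k) (A := A) (I := I) i)
    rw [map_sub] at h
    rw [one_smul]
    exact sub_eq_zero.1 h
  · refine ⟨0, fun _ => rfl, ?_⟩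
    rw [zero_smul]
    exact toTilde_eq_zero_of_rel (I := I) (Rel.e_f_diff (k := k) (A := A) (I := I) i j hij)

/-- For `s = false` anticommutativity produces h_j in place of h_i. The vanishing of `c` off the
diagonal is what lets one formula cover both signs. -/
theorem exists_bracket_chevalley_chevalley (s : Bool) (i j : Fin n) :
    ∃ c : k, (i ≠ j → c = 0) ∧
      tildeBracket k A I (tildeMon k A I (chevalley s i)) (tildeMon k A I (chevalley (!s) j)) =
        c • tildeMon k A I (.of (.h i)) := by
  cases s
  · obtain ⟨c, hc, h⟩ := exists_bracket_e_f (k := k) (A := A) (I := I) j i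
    rw [tildeBracket_anticomm, Bool.not_false, h, smul_smul, ← neg_smul]
    by_cases hij : i = j
    · subst hij
      exact ⟨_, fun h => absurd rfl h, rfl⟩
    · exact ⟨0, fun _ => rfl, by simp [hc (Ne.symm hij)]⟩
  · exact exists_bracket_e_f i j

theorem exists_bracket_h_word {s : Bool} {m : FreeMagma (Gen n)} (hm : IsWord s m) (i : Fin n) :
    ∃ c : k, tildeBracket k A I (tildeMon k A I (.of (.h i))) (tildeMon k A I m) =
      c • tildeMon k A I m := by
  induction hm with
  | of j => exact exists_bracket_h_chevalley s i j
  | cons j m _ ih =>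
    obtain ⟨c, hc⟩ := ih
    obtain ⟨c', hc'⟩ := exists_bracket_h_chevalley (k := k) (A := A) (I := I) s i j
    rw [tildeMon_mul, tildeBracket_jacobi, hc, hc', map_smul, map_smul, LinearMap.smul_apply,
      smul_smul, ← add_smul]
    exact ⟨_, rfl⟩

theorem bracket_chevalley_mem_wordSpan {s : Bool} {d : Fin n → ℤ} (i : Fin n) {x : Tilde k A I}
    (hx : x ∈ wordSpan k A I s d ⊔ cartanSpan k A I d) :
    tildeBracket k A I (tildeMon k A I (chevalley s i)) x ∈
      wordSpan k A I s (deg (chevalley s i) + d) := by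
  revert x
  change _ ≤ (wordSpan k A I s (deg (chevalley s i) + d)).comap (tildeBracket k A I _)
  refine sup_le ?_ ?_ <;> refine Submodule.span_le.2 ?_
  · rintro _ ⟨m, hm, rfl, rfl⟩
    rw [SetLike.mem_coe, Submodule.mem_comap, ← tildeMon_mul, ← deg_mul]
    exact mem_wordSpan (.cons i m hm)
  · rintro _ ⟨rfl, j, rfl⟩
    obtain ⟨c, hc⟩ := exists_bracket_chevalley_h (k := k) (A := A) (I := I) s j i
    rw [SetLike.mem_coe, Submodule.mem_comap, hc, add_zero]
    exact Submodule.smul_mem _ _ (mem_wordSpan (.of i))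

theorem deg_chevalley_add_not (s : Bool) (i : Fin n) :
    deg (chevalley s i) + deg (chevalley (!s) i) = 0 := by
  cases s <;> simp [deg_chevalley]

/-- Induction on the word. In [e_i, [f_j, m]] = [[e_i, f_j], m] ± [f_j, [e_i, m]], or the same with
e and f exchanged, the first term is a multiple of m because words are eigenvectors of h_i, and the
second is covered by the induction hypothesis. A Cartan term arises only from a one-letter word. -/
theorem bracket_chevalley_word_not {s : Bool} (i : Fin n) {m : FreeMagma (Gen n)}
    (hm : IsWord (!s) m) :
    tildeBracket k A I (tildeMon k A I (chevalley s i)) (tildeMon k A I m) ∈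
      wordSpan k A I (!s) (deg (chevalley s i) + deg m) ⊔
        cartanSpan k A I (deg (chevalley s i) + deg m) := by
  induction hm with
  | of j =>
    obtain ⟨c, hc, h⟩ := exists_bracket_chevalley_chevalley (k := k) (A := A) (I := I) s i j
    rw [h]
    by_cases hij : i = j
    · subst hij
      refine Submodule.mem_sup_right (Submodule.smul_mem _ _ (Submodule.subset_span ?_))
      exact ⟨deg_chevalley_add_not s i, i, rfl⟩
    · rw [hc hij, zero_smul]
      exact zero_mem _
  | cons j m hm ih =>
    obtain ⟨c, hc, h⟩ := exists_bracket_chevalley_chevalley (k := k) (A := A) (I := I) s i j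
    obtain ⟨c', hc'⟩ := exists_bracket_h_word (k := k) (A := A) (I := I) hm i
    rw [tildeMon_mul, tildeBracket_jacobi, h, map_smul, LinearMap.smul_apply, hc', deg_mul]
    refine Submodule.mem_sup_left (add_mem ?_ (Submodule.smul_mem _ _ ?_))
    · by_cases hij : i = j
      · subst hij
        rw [← add_assoc, deg_chevalley_add_not, zero_add]
        exact Submodule.smul_mem _ _ (Submodule.smul_mem _ _ (mem_wordSpan hm))
      · rw [hc hij, zero_smul]
        exact zero_mem _
    · rw [add_left_comm]
      exact bracket_chevalley_mem_wordSpan j ih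

theorem bracket_chevalley_mem_triangular (s : Bool) (i : Fin n) {d : Fin n → ℤ} {x : Tilde k A I}
    (hx : x ∈ triangular k A I d) :
    tildeBracket k A I (tildeMon k A I (chevalley s i)) x ∈
      triangular k A I (deg (chevalley s i) + d) := by
  refine map_mem_of_mem_triangular (tildeBracket k A I _) ?_ ?_ hx
  · rintro s' m hm rfl
    by_cases hs : s' = s
    · subst hs
      exact wordSpan_le_triangular s' _ (bracket_chevalley_mem_wordSpan i
        (Submodule.mem_sup_left (mem_wordSpan hm)))
    · obtain rfl : s' = !s := by cases s <;> cases s' <;> simp_all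
      exact SetLike.le_def.1 (sup_le (wordSpan_le_triangular _ _) (cartanSpan_le_triangular _))
        (bracket_chevalley_word_not i hm)
  · rintro rfl j
    exact wordSpan_le_triangular s _ (bracket_chevalley_mem_wordSpan i
      (Submodule.mem_sup_right (Submodule.subset_span ⟨rfl, j, rfl⟩)))

theorem bracket_h_mem_triangular (i : Fin n) {d : Fin n → ℤ} {x : Tilde k A I}
    (hx : x ∈ triangular k A I d) :
    tildeBracket k A I (tildeMon k A I (.of (.h i))) x ∈ triangular k A I d := by
  refine map_mem_of_mem_triangular (tildeBracket k A I _) ?_ ?_ hx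
  · rintro s m hm rfl
    obtain ⟨c, hc⟩ := exists_bracket_h_word (k := k) (A := A) (I := I) hm i
    rw [hc]
    exact Submodule.smul_mem _ _ (wordSpan_le_triangular s _ (mem_wordSpan hm))
  · rintro rfl j
    rw [bracket_h_h]
    exact zero_mem _

/-- The Jacobi identity, solved for the product with the outer bracket on the left, expresses the
action of a longer word through those of its first letter and of the rest. -/
theorem bracket_word_mem_triangular {s : Bool} {m : FreeMagma (Gen n)} (hm : IsWord s m)
    {d : Fin n → ℤ} {x : Tilde k A I} (hx : x ∈ triangular k A I d) :
    tildeBracket k A I (tildeMon k A I m) x ∈ triangular k A I (deg m + d) := by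
  induction hm generalizing d x with
  | of i => exact bracket_chevalley_mem_triangular s i hx
  | cons i m hm ih =>
    rw [tildeMon_mul, ← sub_eq_iff_eq_add.2 (tildeBracket_jacobi k A I (chevalley s i) m x)]
    rw [deg_mul, add_assoc]
    refine sub_mem (bracket_chevalley_mem_triangular s i (ih hx)) (Submodule.smul_mem _ _ ?_)
    rw [add_left_comm]
    exact ih (bracket_chevalley_mem_triangular s i hx)

theorem bracket_mem_triangular {d d' : Fin n → ℤ} {x y : Tilde k A I}
    (hx : x ∈ triangular k A I d) (hy : y ∈ triangular k A I d') :
    tildeBracket k A I x y ∈ triangular k A I (d + d') := by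
  refine map_mem_of_mem_triangular ((tildeBracket k A I).flip y) ?_ ?_ hx
  · rintro s m hm rfl
    exact bracket_word_mem_triangular hm hy
  · rintro rfl i
    rw [zero_add]
    exact bracket_h_mem_triangular i hy

/-- The triangular pieces contain the generators and multiply with degrees adding, hence exhaust the
algebra. Directness of 𝔫⁺ + 𝔥 + 𝔫⁻ is not needed. -/
theorem tildeMon_mem_triangular (m : FreeMagma (Gen n)) :
    tildeMon k A I m ∈ triangular k A I (deg m) := by
  induction m with
  | ih1 x =>
    cases x with
    | e i => exact wordSpan_le_triangular true _ (mem_wordSpan (.of i))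
    | f i => exact wordSpan_le_triangular false _ (mem_wordSpan (.of i))
    | h i => exact cartanSpan_le_triangular _ (Submodule.subset_span ⟨rfl, i, rfl⟩)
  | ih2 a b ha hb =>
    have := bracket_mem_triangular ha hb
    rwa [← tildeMon_mul] at this

variable (k A I) in
/-- The component of degree `0` of `𝔤̃(A, I)` is `𝔥`. -/
theorem tildeGrading_zero_le : tildeGrading k A I 0 ≤ tildeCartan k A I := by
  refine Submodule.span_le.2 ?_
  rintro _ ⟨m, hm, rfl⟩
  have h := tildeMon_mem_triangular (k := k) (A := A) (I := I) m
  rw [hm] at h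
  -- No word has degree 0, so only the Cartan summand contributes.
  refine map_mem_of_mem_triangular LinearMap.id ?_ ?_ h
  · intro s m hm h0
    exact absurd h0 hm.deg_ne_zero
  · intro _ i
    exact Submodule.subset_span ⟨i, rfl⟩

variable (k A I) in
theorem iSup_tildeGrading : ⨆ d, tildeGrading k A I d = ⊤ := by
  rw [eq_top_iff, ← span_range_tildeMon, Submodule.span_le]
  rintro _ ⟨m, rfl⟩
  exact Submodule.mem_iSup_of_mem (deg m) (Submodule.subset_span ⟨m, rfl, rfl⟩)

variable (k A I) in
theorem iSup_tildeParity : ⨆ p, tildeParity k A I p = ⊤ := by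
  rw [eq_top_iff, ← span_range_tildeMon, Submodule.span_le]
  rintro _ ⟨m, rfl⟩
  exact Submodule.mem_iSup_of_mem (parity I m) (Submodule.subset_span ⟨m, rfl, rfl⟩)

end Triangular

end Contragredient

end

/-! ### Graded linear maps -/

noncomputable section

section Linear

variable {k : Type*} [Field k] {L M ι : Type*} [AddCommGroup L] [Module k L]
  [AddCommGroup M] [Module k M]

/-- The kernel of a graded linear map is graded. -/
theorem ker_eq_iSup_inf_of_graded (π : L →ₗ[k] M) (S : ι → Submodule k L) (G : ι → Submodule k M)
    (hS : ⨆ d, S d = ⊤) (hG : iSupIndep G) (hπ : ∀ d, S d ≤ (G d).comap π) :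
    LinearMap.ker π = ⨆ d, LinearMap.ker π ⊓ S d := by
  classical
  refine le_antisymm (fun x hx => ?_) (iSup_le fun _ => inf_le_left)
  have hx' : x ∈ ⨆ d, S d := by rw [hS]; trivial
  -- The components `f d` are merely a choice, as the `S d` are only known to span. Independence of
  -- the `G d` in the target still forces every `π (f d)` to vanish.
  obtain ⟨f, hf, rfl⟩ := (Submodule.mem_iSup_iff_exists_finsupp _ _).1 hx'
  refine Submodule.sum_mem _ fun d hd => Submodule.mem_iSup_of_mem d ⟨?_, hf d⟩
  rw [LinearMap.mem_ker, Finsupp.sum, map_sum] at hx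
  exact (iSupIndep_iff_finsetSum_eq_zero_imp_eq_zero G).1 hG f.support (fun d => π (f d))
    (fun d _ => hπ d (hf d)) hx d hd

/-- A graded surjection maps homogeneous components onto homogeneous components. -/
theorem map_eq_of_graded (π : L →ₗ[k] M) (S : ι → Submodule k L) (G : ι → Submodule k M)
    (hS : ⨆ d, S d = ⊤) (hG : iSupIndep G) (hπ : ∀ d, S d ≤ (G d).comap π)
    (hsurj : Function.Surjective π) (d : ι) : (S d).map π = G d := by
  refine le_antisymm (Submodule.map_le_iff_le_comap.2 (hπ d)) fun y hy => ?_
  obtain ⟨x, rfl⟩ := hsurj y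
  have hx : x ∈ S d ⊔ ⨆ d' ≠ d, S d' := by
    have : (⨆ d, S d) ≤ S d ⊔ ⨆ d' ≠ d, S d' := iSup_le fun d' => by
      by_cases h : d' = d
      · subst h; exact le_sup_left
      · exact (le_iSup₂ (f := fun d' (_ : d' ≠ d) => S d') d' h).trans le_sup_right
    exact this (hS ▸ Submodule.mem_top)
  obtain ⟨u, hu, v, hv, rfl⟩ := Submodule.mem_sup.1 hx
  have hv' : π v ∈ ⨆ d' ≠ d, G d' := by
    have : ⨆ d' ≠ d, S d' ≤ (⨆ d' ≠ d, G d').comap π :=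
      iSup₂_le fun d' h => (hπ d').trans (Submodule.comap_mono (le_iSup₂_of_le d' h le_rfl))
    exact this hv
  have hvd : π v ∈ G d := by
    have := sub_mem hy (hπ d hu)
    rwa [map_add, add_sub_cancel_left] at this
  -- The image of the remainder lies in `G d` and in the span of the other components.
  have h0 : π v = 0 := (Submodule.disjoint_def.1 (hG d)) _ hvd hv'
  exact ⟨u, hu, by rw [map_add, h0, add_zero]⟩

end Linear

/-! ### Recognition of 𝔤(A, I) among graded Lie superalgebras -/

namespace Contragredient

section Recognition

variable {k : Type*} [Field k] {n : ℕ} {M : Type*} [AddCommGroup M] [Module k M]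

/-- The universal property of the free nonassociative algebra, for a bilinear product. -/
theorem exists_freeAlg_lift (br : M →ₗ[k] M →ₗ[k] M) (g : Gen n → M) :
    ∃ F : FreeAlg k n →ₗ[k] M, (∀ x, F (gen k x) = g x) ∧ ∀ a b, F (a * b) = br (F a) (F b) := by
  -- With `br` as a local multiplication on `M`, the universal property for nonassociative algebras
  -- applies.
  let _ : NonUnitalNonAssocSemiring M :=
    { (inferInstance : AddCommMonoid M) with
      mul := fun x y => br x y
      left_distrib := fun x y z => map_add (br x) y z
      right_distrib := fun x y z => LinearMap.map_add₂ br x y z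
      zero_mul := fun x => LinearMap.map_zero₂ br x
      mul_zero := fun x => map_zero (br x) }
  have : IsScalarTower k M M := ⟨fun c x y => LinearMap.map_smul₂ br c x y⟩
  have : SMulCommClass k M M := ⟨fun c x y => (map_smul (br x) c y).symm⟩
  let F := FreeNonUnitalNonAssocAlgebra.lift k g
  exact ⟨{ toFun := F, map_add' := map_add F, map_smul' := map_smul F },
    fun x => FreeNonUnitalNonAssocAlgebra.lift_of_apply k g x, fun a b => map_mul F a b⟩

variable {A : Matrix (Fin n) (Fin n) k} {I : Fin n → ZMod 2}

/-- The quotient of `𝔤̃(A, I)` by the kernel of a graded surjection that is injective on `𝔥`, onto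
a Lie superalgebra with no nonzero graded ideal avoiding degree `0`, is `𝔤(A, I)`. -/
theorem radical_eq_ker (br : M →ₗ[k] M →ₗ[k] M) (G : (Fin n → ℤ) → Submodule k M)
    (hG : iSupIndep G) (π : Tilde k A I →ₗ[k] M)
    (hπ : ∀ x y, π (tildeBracket k A I x y) = br (π x) (π y)) (hsurj : Function.Surjective π)
    (hdeg : ∀ d, tildeGrading k A I d ≤ (G d).comap π)
    (hind : LinearIndependent k fun i : Fin n => π (toTilde k A I (gen k (.h i))))
    (hideal : ∀ J : Submodule k M, IsTwoSidedIdeal br J → J = ⨆ d, J ⊓ G d → J ⊓ G 0 = ⊥ →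
      J = ⊥) :
    radical k A I = LinearMap.ker π := by
  refine le_antisymm (sSup_le fun J hJ => ?_) (le_sSup ⟨?_, ?_, ?_⟩)
  · obtain ⟨hJ1, hJ2, hJ3⟩ := hJ
    -- The triangular decomposition enters here: avoiding 𝔥 becomes having no part of degree 0.
    have hJ0 : J ⊓ tildeGrading k A I 0 = ⊥ :=
      eq_bot_iff.2 ((inf_le_inf_left J (tildeGrading_zero_le k A I)).trans hJ3.le)
    have hle : ∀ d, (J ⊓ tildeGrading k A I d).map π ≤ J.map π ⊓ G d := fun d =>
      le_inf (Submodule.map_mono inf_le_left)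
        ((Submodule.map_mono inf_le_right).trans (Submodule.map_le_iff_le_comap.2 (hdeg d)))
    have hsum : J.map π = ⨆ d, (J ⊓ tildeGrading k A I d).map π := by
      rw [← Submodule.map_iSup, ← hJ2]
    have hbot : J.map π = ⊥ := by
      refine hideal _ ?_ ?_ ?_
      · rintro x _ ⟨y, hy, rfl⟩
        obtain ⟨x, rfl⟩ := hsurj x
        rw [← hπ, ← hπ]
        exact ⟨Submodule.mem_map_of_mem (hJ1 x y hy).1, Submodule.mem_map_of_mem (hJ1 x y hy).2⟩
      · exact le_antisymm (hsum.le.trans (iSup_mono hle)) (iSup_le fun _ => inf_le_left)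
      -- `J.map π` is a sum of images of nonzero degree, and these are independent of `G 0`.
      · refine (Disjoint.mono_left ?_ (hG 0).symm).eq_bot
        refine hsum.le.trans (iSup_le fun d => ?_)
        by_cases hd : d = 0
        · subst hd
          rw [hJ0, Submodule.map_bot]
          exact bot_le
        · exact (hle d).trans (inf_le_right.trans (le_iSup₂_of_le d hd le_rfl))
    exact Submodule.map_le_iff_le_comap.1 hbot.le
  · intro x y hy
    rw [LinearMap.mem_ker] at hy
    simp [hπ, hy]
  · exact ker_eq_iSup_inf_of_graded π _ G (iSup_tildeGrading k A I) hG hdeg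
  -- An element of 𝔥 in the kernel is a linear relation among the images of the h_i.
  · refine eq_bot_iff.2 ?_
    rintro x ⟨hx, hc⟩
    obtain ⟨c, rfl⟩ := (Submodule.mem_span_range_iff_exists_fun k).1 hc
    have hx : π (∑ i, c i • toTilde k A I (gen k (.h i))) = 0 := hx
    rw [map_sum] at hx
    simp only [map_smul] at hx
    have := Fintype.linearIndependent_iff.1 hind c hx
    simp [this]

variable (A) in
/-- Elements of a bilinear algebra that satisfy the Chevalley relations. -/
structure IsChevalley (br : M →ₗ[k] M →ₗ[k] M) (g : Gen n → M) : Prop where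
  h_h (i j : Fin n) : br (g (.h i)) (g (.h j)) = 0
  e_f_same (i : Fin n) : br (g (.e i)) (g (.f i)) = g (.h i)
  e_f_diff (i j : Fin n) (hij : i ≠ j) : br (g (.e i)) (g (.f j)) = 0
  h_e (i j : Fin n) : br (g (.h i)) (g (.e j)) = A i j • g (.e j)
  h_f (i j : Fin n) : br (g (.h i)) (g (.f j)) = -(A i j • g (.f j))

/-- The kernel of the lift from the free algebra is an ideal, so it is enough that it contains the
relations. The two signed families hold because monomials go to homogeneous elements of the same
parity. -/
theorem IsChevalley.exists_tilde_lift {P : ZMod 2 → Submodule k M} {br : M →ₗ[k] M →ₗ[k] M}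
    (hL : IsLieSuperalgebra P br) {g : Gen n → M} (hg : IsChevalley A br g)
    (hP : ∀ x, g x ∈ P (genParity I x)) :
    ∃ π : Tilde k A I →ₗ[k] M, (∀ x, π (toTilde k A I (gen k x)) = g x) ∧
      (∀ x y, π (tildeBracket k A I x y) = br (π x) (π y)) := by
  obtain ⟨F, hFg, hF⟩ := exists_freeAlg_lift br g
  have hFP : ∀ m, F (mon k m) ∈ P (parity I m) := by
    intro m
    induction m with
    | ih1 x => rw [mon_of, hFg]; exact hP x
    | ih2 a b ha hb => rw [mon_mul, hF]; exact hL.bracket_mem _ _ _ _ ha hb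
  have hker : relIdeal k A I ≤ LinearMap.ker F := by
    refine sInf_le ⟨?_, ?_⟩
    · intro x y hy
      rw [LinearMap.mem_ker] at hy
      simp [hF, hy]
    · intro x hx
      rw [SetLike.mem_coe, LinearMap.mem_ker]
      cases hx with
      | superAnticomm a b =>
        rw [map_add, map_smul, hF, hF, hL.superAnticomm _ _ _ _ (hFP a) (hFP b)]
        exact neg_add_cancel _
      | superJacobi a b c =>
        simp only [map_sub, map_smul, hF]
        rw [hL.superJacobi _ _ _ _ _ (hFP a) (hFP b)]
        abel
      | h_h i j => rw [hF, hFg, hFg, hg.h_h]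
      | e_f_same i => rw [map_sub, hF, hFg, hFg, hFg, hg.e_f_same, sub_self]
      | e_f_diff i j hij => rw [hF, hFg, hFg, hg.e_f_diff i j hij]
      | h_e i j => rw [map_sub, map_smul, hF, hFg, hFg, hg.h_e, sub_self]
      | h_f i j => rw [map_add, map_smul, hF, hFg, hFg, hg.h_f, neg_add_cancel]
  refine ⟨(relIdeal k A I).liftQ F hker, fun x => hFg x, fun x y => ?_⟩
  obtain ⟨x, rfl⟩ := Submodule.mkQ_surjective _ x
  obtain ⟨y, rfl⟩ := Submodule.mkQ_surjective _ y
  exact hF x y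

/-- Recognition of `𝔤(A, I)`: a graded Lie superalgebra generated by elements that satisfy the
Chevalley relations, with linearly independent `h_i`, and without nonzero graded ideals avoiding
degree `0`. -/
theorem superalgebraIso_alg {P : ZMod 2 → Submodule k M} {br : M →ₗ[k] M →ₗ[k] M}
    (hL : IsLieSuperalgebra P br) {g : Gen n → M} (hg : IsChevalley A br g)
    (hP : ∀ x, g x ∈ P (genParity I x))
    (G : (Fin n → ℤ) → Submodule k M) (hG : iSupIndep G)
    (hGmul : ∀ d d' x y, x ∈ G d → y ∈ G d' → br x y ∈ G (d + d'))
    (hgG : ∀ x, g x ∈ G (genDeg x))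
    (hgen : ∀ S : Submodule k M, (∀ x ∈ S, ∀ y ∈ S, br x y ∈ S) → (∀ x, g x ∈ S) → S = ⊤)
    (hind : LinearIndependent k fun i : Fin n => g (.h i))
    (hideal : ∀ J : Submodule k M, IsTwoSidedIdeal br J → J = ⨆ d, J ⊓ G d → J ⊓ G 0 = ⊥ →
      J = ⊥) :
    SuperalgebraIso P br (algParity k A I) (bracket k A I) := by
  obtain ⟨π, hπg, hπ⟩ := hg.exists_tilde_lift hL hP
  have hmon : ∀ m, π (tildeMon k A I m) ∈ P (parity I m) ∧ π (tildeMon k A I m) ∈ G (deg m) := by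
    intro m
    induction m with
    | ih1 x =>
      rw [tildeMon, mon_of, hπg]
      exact ⟨hP x, hgG x⟩
    | ih2 a b ha hb =>
      rw [tildeMon_mul, hπ]
      exact ⟨hL.bracket_mem _ _ _ _ ha.1 hb.1, hGmul _ _ _ _ ha.2 hb.2⟩
  have hsurj : Function.Surjective π := by
    refine LinearMap.range_eq_top.1 (hgen _ ?_ ?_)
    · rintro _ ⟨x, rfl⟩ _ ⟨y, rfl⟩
      exact ⟨tildeBracket k A I x y, hπ x y⟩
    · exact fun x => ⟨_, hπg x⟩
  have hdeg : ∀ d, tildeGrading k A I d ≤ (G d).comap π := by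
    refine fun d => Submodule.span_le.2 ?_
    rintro _ ⟨m, rfl, rfl⟩
    exact (hmon m).2
  have hpar : ∀ p, tildeParity k A I p ≤ (P p).comap π := by
    refine fun p => Submodule.span_le.2 ?_
    rintro _ ⟨m, rfl, rfl⟩
    exact (hmon m).1
  have hrad : radical k A I = LinearMap.ker π := by
    refine radical_eq_ker br G hG π hπ hsurj hdeg ?_ hideal
    simpa only [hπg] using hind
  -- The inverse of the isomorphism induced by π, so that φ ∘ π is the quotient map.
  let φ : M ≃ₗ[k] Alg k A I :=
    ((Submodule.quotEquivOfEq _ _ hrad).trans (π.quotKerEquivOfSurjective hsurj)).symm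
  have hφ : ∀ t, φ (π t) = (radical k A I).mkQ t := fun t =>
    (LinearEquiv.symm_apply_eq _).2 rfl
  refine ⟨φ, fun p => ?_, fun x y => ?_⟩
  · rw [← map_eq_of_graded π _ P (iSup_tildeParity k A I) hL.isInternal.submodule_iSupIndep hpar
      hsurj p, ← Submodule.map_comp, algParity]
    congr 1
    exact LinearMap.ext hφ
  · obtain ⟨x, rfl⟩ := hsurj x
    obtain ⟨y, rfl⟩ := hsurj y
    rw [← hπ, hφ, hφ, hφ]
    rfl

end Recognition

end Contragredient

end

noncomputable section

namespace Br25Table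

/-! ### Sparse integer vectors -/

section Sparse

/-- Multiplication of a sparse vector by an integer. -/
def smulList {ι : Type*} (c : ℤ) (l : List (ι × ℤ)) : List (ι × ℤ) := l.map fun t => (t.1, c * t.2)

/-- Change of index set of a sparse vector. -/
def reindex {ι κ : Type*} (f : ι → κ) (l : List (ι × ℤ)) : List (κ × ℤ) :=
  l.map fun t => (f t.1, t.2)

/-- Tensor product of sparse vectors. -/
def tensorList {ι κ : Type*} (l : List (ι × ℤ)) (l' : List (κ × ℤ)) : List ((ι × κ) × ℤ) :=
  l.flatMap fun t => l'.map fun t' => ((t.1, t'.1), t.2 * t'.2)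

/-- The product of sparse vectors given by structure constants. -/
def mulList {ι κ ν : Type*} (T : ι → κ → List (ν × ℤ)) (l : List (ι × ℤ)) (l' : List (κ × ℤ)) :
    List (ν × ℤ) :=
  l.flatMap fun t => l'.flatMap fun t' => smulList (t.2 * t'.2) (T t.1 t'.1)

/-- A coefficient of a sparse vector. -/
def coeffList {ι : Type*} [DecidableEq ι] (i : ι) (l : List (ι × ℤ)) : ℤ :=
  (l.map fun t => if t.1 = i then t.2 else 0).sum

/-- All coefficients of a sparse vector are divisible by `5`. -/
def isZeroList {ι : Type*} [DecidableEq ι] (l : List (ι × ℤ)) : Bool :=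
  l.all fun t => coeffList t.1 l % 5 == 0

variable {k : Type*} [Field k] {ι κ ν M N E : Type*} [AddCommGroup M] [Module k M]
  [AddCommGroup N] [Module k N] [AddCommGroup E] [Module k E]

variable (k) in
/-- The vector with the given sparse coordinates. -/
def eval (b : ι → M) (l : List (ι × ℤ)) : M := (l.map fun t => (t.2 : k) • b t.1).sum

@[simp]
theorem eval_nil (b : ι → M) : eval k b [] = 0 := rfl

@[simp]
theorem eval_cons (b : ι → M) (t : ι × ℤ) (l : List (ι × ℤ)) :
    eval k b (t :: l) = (t.2 : k) • b t.1 + eval k b l := rfl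

@[simp]
theorem eval_append (b : ι → M) (l l' : List (ι × ℤ)) :
    eval k b (l ++ l') = eval k b l + eval k b l' := by
  simp [eval]

@[simp]
theorem eval_smulList (b : ι → M) (c : ℤ) (l : List (ι × ℤ)) :
    eval k b (smulList c l) = (c : k) • eval k b l := by
  induction l with
  | nil => simp [smulList]
  | cons t l ih =>
    change eval k b ((t.1, c * t.2) :: smulList c l) = _
    simp [ih, mul_smul]

@[simp]
theorem eval_reindex (b : κ → M) (f : ι → κ) (l : List (ι × ℤ)) :
    eval k b (reindex f l) = eval k (fun i => b (f i)) l := by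
  simp [eval, reindex, Function.comp_def]

theorem map_eval (F : M →ₗ[k] N) (b : ι → M) (l : List (ι × ℤ)) :
    F (eval k b l) = eval k (fun i => F (b i)) l := by
  induction l with
  | nil => simp
  | cons t l ih => simp [ih]

/-- The bridge from bilinear algebra to list arithmetic: nested products of coordinate vectors
become lists that can be evaluated. -/
theorem map_eval_eval (F : M →ₗ[k] N →ₗ[k] E) {b : ι → M} {b' : κ → N} {b'' : ν → E}
    {T : ι → κ → List (ν × ℤ)} (hT : ∀ i j, F (b i) (b' j) = eval k b'' (T i j))
    (l : List (ι × ℤ)) (l' : List (κ × ℤ)) :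
    F (eval k b l) (eval k b' l') = eval k b'' (mulList T l l') := by
  induction l with
  | nil => simp [mulList]
  | cons t l ih =>
    have h : mulList T (t :: l) l' =
        (l'.flatMap fun t' => smulList (t.2 * t'.2) (T t.1 t'.1)) ++ mulList T l l' := rfl
    rw [h, eval_append, ← ih, eval_cons, map_add, LinearMap.add_apply]
    congr 1
    clear h ih
    induction l' with
    | nil => simp
    | cons t' l' ih =>
      rw [List.flatMap_cons, eval_append, ← ih]
      simp [hT, mul_smul]

theorem eval_tensorList (b : ι → M) (b' : κ → N) (l : List (ι × ℤ)) (l' : List (κ × ℤ)) :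
    eval k (fun p : ι × κ => b p.1 ⊗ₜ[k] b' p.2) (tensorList l l') =
      eval k b l ⊗ₜ[k] eval k b' l' := by
  have h := map_eval_eval (TensorProduct.mk k M N) (b := b) (b' := b')
    (b'' := fun p : ι × κ => b p.1 ⊗ₜ[k] b' p.2) (T := fun i j => [((i, j), 1)])
    (fun i j => by simp) l l'
  rw [TensorProduct.mk_apply] at h
  rw [h]
  congr 1
  simp [mulList, tensorList, smulList, List.map_eq_flatMap]

theorem eval_eq_sum [Fintype ι] [DecidableEq ι] (b : ι → M) (l : List (ι × ℤ)) :
    eval k b l = ∑ i, (coeffList i l : k) • b i := by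
  induction l with
  | nil => simp [coeffList]
  | cons t l ih =>
    have h : ∀ i, coeffList i (t :: l) = (if t.1 = i then t.2 else 0) + coeffList i l := fun _ => rfl
    simp [h, ih, add_smul, Finset.sum_add_distrib, ite_smul]

/-- A decidable test on integers becomes a vector identity in characteristic 5. The test visits only
indices that occur in the list; all other coefficients are 0. -/
theorem eval_eq_zero [CharP k 5] [Fintype ι] [DecidableEq ι] (b : ι → M) {l : List (ι × ℤ)}
    (hl : isZeroList l = true) : eval k b l = 0 := by
  rw [eval_eq_sum]
  refine Finset.sum_eq_zero fun i _ => ?_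
  suffices (coeffList i l : k) = 0 by rw [this, zero_smul]
  by_cases hi : ∃ t ∈ l, t.1 = i
  · obtain ⟨t, ht, rfl⟩ := hi
    have := List.all_eq_true.1 hl t ht
    exact (CharP.intCast_eq_zero_iff k 5 _).2 (Int.dvd_of_emod_eq_zero (by simpa using this))
  · have : coeffList i l = 0 := by
      refine List.sum_eq_zero fun x hx => ?_
      obtain ⟨t, ht, rfl⟩ := List.mem_map.1 hx
      exact if_neg fun h => hi ⟨t, ht, h⟩
    rw [this, Int.cast_zero]

end Sparse

/-! ### The structure constants -/

/-- Indices of a homogeneous basis of the model. -/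
abbrev Idx : Type :=
  (Fin 3 ⊕ Fin 3) ⊕ (Fin 3 × Fin 2) ⊕ (Fin 2 × Fin 3) ⊕ (Fin 2 × Fin 2)

/-- The form on a symplectic basis. -/
def formT : Fin 2 → Fin 2 → ℤ
  | 0, 1 => 1
  | 1, 0 => -1
  | _, _ => 0

/-- The natural action of the standard basis `E, H, F` on a symplectic basis. -/
def actT : Fin 3 → Fin 2 → List (Fin 2 × ℤ)
  | 0, 1 => [(0, 1)]
  | 1, 0 => [(0, 1)]
  | 1, 1 => [(1, -1)]
  | 2, 0 => [(1, 1)]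
  | _, _ => []

/-- The commutators of `E, H, F`. -/
def adT : Fin 3 → Fin 3 → List (Fin 3 × ℤ)
  | 0, 1 => [(0, -2)]
  | 1, 0 => [(0, 2)]
  | 0, 2 => [(1, 1)]
  | 2, 0 => [(1, -1)]
  | 1, 2 => [(2, -2)]
  | 2, 1 => [(2, 2)]
  | _, _ => []

/-- The endomorphisms `γ` of a symplectic basis. -/
def gammaT : Fin 2 → Fin 2 → List (Fin 3 × ℤ)
  | 0, 0 => [(0, 2)]
  | 1, 1 => [(2, -2)]
  | _, _ => [(1, -1)]

/-- The trace form on `E, H, F`. -/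
def trT : Fin 3 → Fin 3 → ℤ
  | 1, 1 => 2
  | 0, 2 => 1
  | 2, 0 => 1
  | _, _ => 0

/-- The structure constants of the model. -/
def table : Idx → Idx → List (Idx × ℤ)
  | .inl (.inl i), .inl (.inl j) => reindex (fun m => .inl (.inl m)) (adT i j)
  | .inl (.inr i), .inl (.inr j) => reindex (fun m => .inl (.inr m)) (adT i j)
  | .inl (.inl _), .inl (.inr _) => []
  | .inl (.inr _), .inl (.inl _) => []
  | .inl (.inl i), .inr (.inl (j, u)) => reindex (fun m => .inr (.inl (m, u))) (adT i j)
  | .inl (.inr i), .inr (.inl (j, u)) => reindex (fun m => .inr (.inl (j, m))) (actT i u)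
  | .inl (.inl i), .inr (.inr (.inl (a, q))) => reindex (fun m => .inr (.inr (.inl (m, q)))) (actT i a)
  | .inl (.inr i), .inr (.inr (.inl (a, q))) => reindex (fun m => .inr (.inr (.inl (a, m)))) (adT i q)
  | .inl (.inl i), .inr (.inr (.inr (a, u))) => reindex (fun m => .inr (.inr (.inr (m, u)))) (actT i a)
  | .inl (.inr i), .inr (.inr (.inr (a, u))) => reindex (fun m => .inr (.inr (.inr (a, m)))) (actT i u)
  | .inr (.inl (j, u)), .inl (.inl i) =>
    smulList (-1) (reindex (fun m => .inr (.inl (m, u))) (adT i j))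
  | .inr (.inl (j, u)), .inl (.inr i) =>
    smulList (-1) (reindex (fun m => .inr (.inl (j, m))) (actT i u))
  | .inr (.inr (.inl (a, q))), .inl (.inl i) =>
    smulList (-1) (reindex (fun m => .inr (.inr (.inl (m, q)))) (actT i a))
  | .inr (.inr (.inl (a, q))), .inl (.inr i) =>
    smulList (-1) (reindex (fun m => .inr (.inr (.inl (a, m)))) (adT i q))
  | .inr (.inr (.inr (a, u))), .inl (.inl i) =>
    smulList (-1) (reindex (fun m => .inr (.inr (.inr (m, u)))) (actT i a))
  | .inr (.inr (.inr (a, u))), .inl (.inr i) =>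
    smulList (-1) (reindex (fun m => .inr (.inr (.inr (a, m)))) (actT i u))
  | .inr (.inl (i, u)), .inr (.inl (j, v)) =>
    smulList (formT u v) (reindex (fun m => .inl (.inl m)) (adT i j)) ++
      smulList (2 * trT i j) (reindex (fun m => .inl (.inr m)) (gammaT u v))
  | .inr (.inr (.inl (a, i))), .inr (.inr (.inl (b, j))) =>
    smulList (-(2 * trT i j)) (reindex (fun m => .inl (.inl m)) (gammaT a b)) ++
      smulList (-formT a b) (reindex (fun m => .inl (.inr m)) (adT i j))
  | .inr (.inr (.inr (a, u))), .inr (.inr (.inr (b, v))) =>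
    smulList (formT u v) (reindex (fun m => .inl (.inl m)) (gammaT a b)) ++
      smulList (formT a b) (reindex (fun m => .inl (.inr m)) (gammaT u v))
  | .inr (.inl (i, u)), .inr (.inr (.inl (a, q))) =>
    reindex (fun p => .inr (.inr (.inr p))) (tensorList (actT i a) (actT q u))
  | .inr (.inr (.inl (a, q))), .inr (.inl (i, u)) =>
    reindex (fun p => .inr (.inr (.inr p))) (tensorList (actT i a) (actT q u))
  | .inr (.inl (i, u)), .inr (.inr (.inr (a, v))) =>
    reindex (fun p => .inr (.inr (.inl p))) (tensorList (actT i a) (gammaT u v))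
  | .inr (.inr (.inr (a, v))), .inr (.inl (i, u)) =>
    smulList (-1) (reindex (fun p => .inr (.inr (.inl p))) (tensorList (actT i a) (gammaT u v)))
  | .inr (.inr (.inl (a, q))), .inr (.inr (.inr (b, v))) =>
    smulList (-1) (reindex (fun p => .inr (.inl p)) (tensorList (gammaT a b) (actT q v)))
  | .inr (.inr (.inr (b, v))), .inr (.inr (.inl (a, q))) =>
    reindex (fun p => .inr (.inl p)) (tensorList (gammaT a b) (actT q v))

/-- Parity of a basis vector. -/
def par : Idx → ZMod 2
  | .inl _ => 0
  | .inr (.inl _) => 1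
  | .inr (.inr (.inl _)) => 1
  | .inr (.inr (.inr _)) => 0

/-- Coordinates in terms of the simple roots of the root `p α + q β`, where `α`, `β` are the weights
of the first vectors of the two symplectic bases. -/
def rootCoord (p q : ℤ) : Fin 2 → ℤ := ![p, 2 * p + q]

/-- Weights of `E, H, F`. -/
def wtS : Fin 3 → ℤ := ![2, 0, -2]

/-- Weights of a symplectic basis. -/
def wtV : Fin 2 → ℤ := ![1, -1]

/-- Degree in `ℤ²` of a basis vector. -/
def deg : Idx → (Fin 2 → ℤ)
  | .inl (.inl i) => rootCoord (wtS i) 0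
  | .inl (.inr i) => rootCoord 0 (wtS i)
  | .inr (.inl (i, u)) => rootCoord (wtS i) (wtV u)
  | .inr (.inr (.inl (a, i))) => rootCoord (wtV a) (wtS i)
  | .inr (.inr (.inr (a, u))) => rootCoord (wtV a) (wtV u)

/-- The sign `(-1)^{ij}` for the parities of two basis vectors. -/
def sgn (i j : Idx) : ℤ := (-1) ^ ((par i).val * (par j).val)

/-- The super Jacobi identity for three basis vectors. -/
def jacobiList (i j l : Idx) : List (Idx × ℤ) :=
  mulList table [(i, 1)] (table j l) ++
    (smulList (-1) (mulList table (table i j) [(l, 1)]) ++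
      smulList (-sgn i j) (mulList table [(j, 1)] (table i l)))

/-- Coordinates of the Chevalley generators. -/
def genList : Contragredient.Gen 2 → List (Idx × ℤ)
  | .e 0 => [(.inr (.inr (.inl (0, 2))), 1)]
  | .e 1 => [(.inr (.inl (1, 0)), 1)]
  | .f 0 => [(.inr (.inr (.inl (1, 0))), -1)]
  | .f 1 => [(.inr (.inl (1, 1)), 1)]
  | .h 0 => [(.inl (.inr 1), -1), (.inl (.inl 1), -2)]
  | .h 1 => [(.inl (.inr 1), 1)]

/-! ### Finite verifications on the 22 basis vectors -/

section Checks

set_option maxRecDepth 100000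
set_option synthInstance.maxHeartbeats 200000
set_option synthInstance.maxSize 2000

/-- Together with `jacobi_table_f`, this covers 4 · 22² triples instead of 22³; the rest follow
because superderivations are closed under the product. -/
theorem jacobi_table_e (i : Fin 2) : ∀ j l : Idx, ∀ t ∈ genList (.e i),
    isZeroList (jacobiList t.1 j l) = true := by
  revert i; decide +kernel

theorem jacobi_table_f (i : Fin 2) : ∀ j l : Idx, ∀ t ∈ genList (.f i),
    isZeroList (jacobiList t.1 j l) = true := by
  revert i; decide +kernel

theorem anticomm_table : ∀ i j : Idx,
    isZeroList (table i j ++ smulList (sgn i j) (table j i)) = true := by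
  decide +kernel

theorem par_table : ∀ i j : Idx, ∀ t ∈ table i j, t.2 = 0 ∨ par t.1 = par i + par j := by
  decide +kernel

/-- The table keeps entries with coefficient 0, for instance those multiplied by `formT u u`, and
their index may have the wrong degree. -/
theorem deg_table : ∀ i j : Idx, ∀ t ∈ table i j, t.2 = 0 ∨ deg t.1 = deg i + deg j := by
  decide +kernel

/-- Root spaces are lines; only degree 0, with the two elements H, has a larger component. -/
theorem eq_of_deg_eq : ∀ i j : Idx, deg i ≠ 0 → deg i = deg j → i = j := by
  decide +kernel

/-- This excludes ideals without degree 0 part: some vector of opposite degree brings each root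
vector back to a nonzero element of degree 0. -/
theorem exists_opposite : ∀ i : Idx, deg i ≠ 0 →
    ∃ j m : Idx, deg j + deg i = 0 ∧ coeffList m (table j i) % 5 ≠ 0 := by
  decide +kernel

/-- The Chevalley generators generate all basis vectors. -/
theorem idx_induction {Q : Idx → Prop}
    (he : ∀ i : Fin 2, ∀ t ∈ genList (.e i), Q t.1) (hf : ∀ i : Fin 2, ∀ t ∈ genList (.f i), Q t.1)
    (hstep : ∀ i j m c, isZeroList (table i j ++ [(m, -c)]) = true → c % 5 ≠ 0 → Q i → Q j → Q m) :
    ∀ i, Q i := by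
  -- The letters s1, s2, x, y, z stand for 𝔰𝔭(V₁), 𝔰𝔭(V₂), 𝔰𝔭(V₁) ⊗ V₂, V₁ ⊗ 𝔰𝔭(V₂) and V₁ ⊗ V₂.
  have h_y_0_2 := he 0 _ (List.mem_singleton_self _)
  have h_x_1_0 := he 1 _ (List.mem_singleton_self _)
  have h_y_1_0 := hf 0 _ (List.mem_singleton_self _)
  have h_x_1_1 := hf 1 _ (List.mem_singleton_self _)
  -- In each step the product of two vectors already reached is a multiple of a new one. The integer
  -- is that coefficient modulo 5; for example [H ⊗ v₀, H ⊗ v₀] = 8E gives 3 below.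
  have h_z_0_1 := hstep _ _ (.inr (.inr (.inr (0, 1)))) 1 (by decide +kernel) (by decide) h_y_0_2 h_x_1_0
  have h_s2_0 := hstep _ _ (.inl (.inr 0)) 3 (by decide +kernel) (by decide) h_x_1_0 h_x_1_0
  have h_s2_1 := hstep _ _ (.inl (.inr 1)) 1 (by decide +kernel) (by decide) h_x_1_0 h_x_1_1
  have h_y_0_1 := hstep _ _ (.inr (.inr (.inl (0, 1)))) 4 (by decide +kernel) (by decide) h_x_1_0 h_z_0_1
  have h_z_1_0 := hstep _ _ (.inr (.inr (.inr (1, 0)))) 4 (by decide +kernel) (by decide) h_y_1_0 h_x_1_1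
  have h_s2_2 := hstep _ _ (.inl (.inr 2)) 2 (by decide +kernel) (by decide) h_x_1_1 h_x_1_1
  have h_y_1_1 := hstep _ _ (.inr (.inr (.inl (1, 1)))) 1 (by decide +kernel) (by decide) h_x_1_1 h_z_1_0
  have h_z_0_0 := hstep _ _ (.inr (.inr (.inr (0, 0)))) 1 (by decide +kernel) (by decide) h_x_1_0 h_y_0_1
  have h_z_1_1 := hstep _ _ (.inr (.inr (.inr (1, 1)))) 1 (by decide +kernel) (by decide) h_x_1_1 h_y_1_1
  have h_x_0_1 := hstep _ _ (.inr (.inl (0, 1))) 3 (by decide +kernel) (by decide) h_z_0_1 h_y_0_1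
  have h_s1_0 := hstep _ _ (.inl (.inl 0)) 3 (by decide +kernel) (by decide) h_z_0_1 h_z_0_0
  have h_y_0_0 := hstep _ _ (.inr (.inr (.inl (0, 0)))) 3 (by decide +kernel) (by decide) h_s2_0 h_y_0_1
  have h_x_0_0 := hstep _ _ (.inr (.inl (0, 0))) 1 (by decide +kernel) (by decide) h_s2_0 h_x_0_1
  have h_s1_1 := hstep _ _ (.inl (.inl 1)) 4 (by decide +kernel) (by decide) h_y_0_1 h_y_1_1
  have h_x_2_0 := hstep _ _ (.inr (.inl (2, 0))) 3 (by decide +kernel) (by decide) h_z_1_0 h_y_1_1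
  have h_s1_2 := hstep _ _ (.inl (.inl 2)) 3 (by decide +kernel) (by decide) h_z_1_0 h_z_1_1
  have h_y_1_2 := hstep _ _ (.inr (.inr (.inl (1, 2)))) 2 (by decide +kernel) (by decide) h_s2_2 h_y_1_1
  have h_x_2_1 := hstep _ _ (.inr (.inl (2, 1))) 1 (by decide +kernel) (by decide) h_s2_2 h_x_2_0
  rintro ((i | i) | ⟨i, j⟩ | ⟨i, j⟩ | ⟨i, j⟩) <;> fin_cases i <;> try fin_cases j
  all_goals assumption

end Checks

end Br25Table

end

noncomputable section

/-! ### Gradings by labels of basis vectors -/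

section Sector

variable {k : Type*} [Field k] {M ι δ : Type*} [AddCommGroup M] [Module k M]

/-- The span of the basis vectors with label `d`. -/
def sector (b : Module.Basis ι k M) (f : ι → δ) (d : δ) : Submodule k M :=
  Submodule.span k (b '' {i | f i = d})

theorem basis_mem_sector (b : Module.Basis ι k M) (f : ι → δ) (i : ι) : b i ∈ sector b f (f i) :=
  Submodule.subset_span ⟨i, rfl, rfl⟩

theorem repr_eq_zero_of_mem_sector {b : Module.Basis ι k M} {f : ι → δ} {d : δ} {x : M}
    (hx : x ∈ sector b f d) {i : ι} (hi : f i ≠ d) : b.repr x i = 0 := by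
  by_contra h
  exact hi (b.mem_span_image.1 hx (Finsupp.mem_support_iff.2 h))

theorem mem_sector {b : Module.Basis ι k M} {f : ι → δ} {d : δ} {x : M} :
    x ∈ sector b f d ↔ ∀ i, f i ≠ d → b.repr x i = 0 := by
  refine ⟨fun hx i hi => repr_eq_zero_of_mem_sector hx hi, fun h => b.mem_span_image.2 fun i hi => ?_⟩
  by_contra hd
  exact Finsupp.mem_support_iff.1 hi (h i hd)

theorem iSupIndep_sector (b : Module.Basis ι k M) (f : ι → δ) : iSupIndep (sector b f) := by
  classical
  refine (iSupIndep_iff_finsetSum_eq_zero_imp_eq_zero _).2 fun s v hv hsum d hd => ?_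
  refine b.repr.map_eq_zero_iff.1 (Finsupp.ext fun i => ?_)
  by_cases hi : f i = d
  · have h := congrArg (fun x => b.repr x i) hsum
    simp only [map_sum, Finsupp.finsetSum_apply, map_zero, Finsupp.coe_zero, Pi.zero_apply] at h
    rw [Finset.sum_eq_single_of_mem d hd] at h
    · exact h
    · intro d' hd' hne
      exact repr_eq_zero_of_mem_sector (hv d' hd') fun h => hne (h ▸ hi)
  · exact repr_eq_zero_of_mem_sector (hv d hd) hi

theorem iSup_sector (b : Module.Basis ι k M) (f : ι → δ) : ⨆ d, sector b f d = ⊤ := by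
  rw [eq_top_iff, ← b.span_eq, Submodule.span_le]
  rintro _ ⟨i, rfl⟩
  exact Submodule.mem_iSup_of_mem (f i) (basis_mem_sector b f i)

theorem sector_le {b : Module.Basis ι k M} {f : ι → δ} {d : δ} {S : Submodule k M}
    (h : ∀ i, f i = d → b i ∈ S) : sector b f d ≤ S := by
  refine Submodule.span_le.2 ?_
  rintro _ ⟨i, hi, rfl⟩
  exact h i hi

theorem bilin_mem_of_mem_sector {b : Module.Basis ι k M} {f : ι → δ} {d d' : δ}
    {F : M →ₗ[k] M →ₗ[k] M} {S : Submodule k M}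
    (h : ∀ i j, f i = d → f j = d' → F (b i) (b j) ∈ S) {x y : M} (hx : x ∈ sector b f d)
    (hy : y ∈ sector b f d') : F x y ∈ S := by
  have h1 : ∀ i, f i = d → F (b i) y ∈ S := fun i hi =>
    sector_le (S := S.comap (F (b i))) (fun j hj => h i j hi hj) hy
  exact sector_le (S := S.comap (F.flip y)) h1 hx

end Sector

/-! ### Superderivations -/

section Derivation

variable {k : Type*} [Field k] {M : Type*} [AddCommGroup M] [Module k M]

/-- The elements of parity `p` that satisfy the super Jacobi identity. -/
def superDer (P : ZMod 2 → Submodule k M) (br : M →ₗ[k] M →ₗ[k] M) (p : ZMod 2) :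
    Submodule k M where
  carrier := {x | x ∈ P p ∧ ∀ j, ∀ y ∈ P j, ∀ z,
    br x (br y z) = br (br x y) z + superSign k p j • br y (br x z)}
  zero_mem' := ⟨zero_mem _, by simp⟩
  add_mem' := by
    rintro x x' ⟨hx, h⟩ ⟨hx', h'⟩
    refine ⟨add_mem hx hx', fun j y hy z => ?_⟩
    simp only [map_add, LinearMap.add_apply, h j y hy, h' j y hy, smul_add]
    abel
  smul_mem' := by
    rintro c x ⟨hx, h⟩
    refine ⟨Submodule.smul_mem _ _ hx, fun j y hy z => ?_⟩
    simp only [map_smul, LinearMap.smul_apply, h j y hy, smul_add, smul_comm c]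

theorem superSign_add_left (i j l : ZMod 2) :
    superSign k (i + j) l = superSign k i l * superSign k j l := by
  rw [superSign, superSign, superSign, ← pow_add, ← add_mul, ZMod.val_add, pow_mul,
    ← neg_one_pow_eq_pow_mod_two, ← pow_mul]

theorem superSign_comm (i j : ZMod 2) : superSign k i j = superSign k j i := by
  rw [superSign, superSign, mul_comm]

theorem superSign_mul_self (i j : ZMod 2) : superSign k i j * superSign k i j = 1 := by
  rw [superSign, ← mul_pow]
  simp

/-- The supercommutator of two superderivations is again one, and left multiplication by `br x y` is
the supercommutator of those by `x` and `y`. No symmetry of the product is used. -/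
theorem bracket_mem_superDer {P : ZMod 2 → Submodule k M} {br : M →ₗ[k] M →ₗ[k] M}
    (hP : ∀ (i j : ZMod 2) (x y : M), x ∈ P i → y ∈ P j → br x y ∈ P (i + j)) {p q : ZMod 2}
    {x y : M} (hx : x ∈ superDer P br p) (hy : y ∈ superDer P br q) :
    br x y ∈ superDer P br (p + q) := by
  obtain ⟨hxp, hx⟩ := hx
  obtain ⟨hyq, hy⟩ := hy
  refine ⟨hP _ _ _ _ hxp hyq, fun j w hw z => ?_⟩
  -- The identity for `x`, applied to `y`, read as a formula for left multiplication by `br x y`.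
  have e : ∀ u, br (br x y) u = br x (br y u) - superSign k p q • br y (br x u) := fun u =>
    eq_sub_of_add_eq (hx q y hyq u).symm
  rw [e, e, e, hy j w hw, hx j w hw, map_add, map_add, map_smul, map_smul,
    hx _ _ (hP _ _ _ _ hyq hw), hy _ _ (hP _ _ _ _ hxp hw), hx j w hw, hy j w hw,
    map_sub, map_smul, LinearMap.sub_apply, LinearMap.smul_apply, map_sub, map_smul,
    superSign_add_left, superSign_comm p (q + j), superSign_add_left,
    superSign_comm q (p + j), superSign_add_left, superSign_comm j p, superSign_comm j q,
    superSign_comm q p]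
  have h := superSign_mul_self (k := k) p q
  set a := superSign k p q
  set c := superSign k p j
  set d := superSign k q j
  have h2 : a * (a * d) = d := by rw [← mul_assoc, h, one_mul]
  simp only [smul_add, smul_sub, smul_smul, h2]
  module

end Derivation

/-! ### From the table to the superalgebra and to 𝔟𝔯(2;5) -/

namespace Br25Table

section Coordinates

variable {k : Type*} [Field k] {M : Type*} [AddCommGroup M] [Module k M]

theorem superSign_par (i j : Idx) : superSign k (par i) (par j) = (sgn i j : k) := by
  simp [superSign, sgn]

theorem repr_eval {ι : Type*} [Fintype ι] [DecidableEq ι] (b : Module.Basis ι k M)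
    (l : List (ι × ℤ)) (m : ι) : b.repr (eval k b l) m = (coeffList m l : k) := by
  rw [eval_eq_sum]
  simp [Finsupp.single_apply]

/-- The Chevalley generators. -/
def chevalleyGen (b : Module.Basis Idx k M) (x : Contragredient.Gen 2) : M := eval k b (genList x)

theorem chevalleyGen_mem_sector {δ : Type*} {f : Idx → δ} (b : Module.Basis Idx k M) (x : Contragredient.Gen 2) {d : δ}
    (h : ∀ t ∈ genList x, f t.1 = d) : chevalleyGen b x ∈ sector b f d := by
  refine list_sum_mem fun v hv => ?_
  obtain ⟨t, ht, rfl⟩ := List.mem_map.1 hv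
  rw [← h t ht]
  exact Submodule.smul_mem _ _ (basis_mem_sector b f t.1)

theorem bracket_basis_mem_sector {b : Module.Basis Idx k M} {br : M →ₗ[k] M →ₗ[k] M}
    (hT : ∀ i j, br (b i) (b j) = eval k b (table i j))
    {δ : Type*} [AddCommGroup δ] {f : Idx → δ}
    (hf : ∀ i j : Idx, ∀ t ∈ table i j, t.2 = 0 ∨ f t.1 = f i + f j) (d d' : δ) (x y : M)
    (hx : x ∈ sector b f d) (hy : y ∈ sector b f d') : br x y ∈ sector b f (d + d') := by
  refine bilin_mem_of_mem_sector ?_ hx hy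
  rintro i j rfl rfl
  rw [hT]
  refine list_sum_mem fun v hv => ?_
  obtain ⟨t, ht, rfl⟩ := List.mem_map.1 hv
  rcases hf i j t ht with h | h
  · simp [h]
  · rw [← h]
    exact Submodule.smul_mem _ _ (basis_mem_sector b f t.1)

end Coordinates

variable {k : Type*} [Field k] [CharP k 5] {M : Type*} [AddCommGroup M] [Module k M]
  {b : Module.Basis Idx k M} {br : M →ₗ[k] M →ₗ[k] M}

theorem basis_mem_superDer (hT : ∀ i j, br (b i) (b j) = eval k b (table i j)) {i : Idx}
    (h : ∀ j l, isZeroList (jacobiList i j l) = true) :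
    b i ∈ superDer (sector b par) br (par i) := by
  refine ⟨basis_mem_sector b par i, fun p y hy z => ?_⟩
  have h0 : ∀ i, b i = eval k b [(i, 1)] := fun i => by simp
  have key : ∀ j, par j = p → ∀ l, br (b i) (br (b j) (b l)) =
      br (br (b i) (b j)) (b l) + superSign k (par i) p • br (b j) (br (b i) (b l)) := by
    rintro j rfl l
    have := eval_eq_zero (k := k) b (h j l)
    rw [jacobiList, eval_append, eval_append, eval_smulList, eval_smulList,
      ← map_eval_eval br hT, ← map_eval_eval br hT, ← map_eval_eval br hT, ← hT, ← hT, ← hT,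
      ← h0, ← h0, ← h0] at this
    rw [superSign_par, ← sub_eq_zero, ← this]
    push_cast
    module
  have key2 : ∀ j, par j = p → ∀ z, br (b i) (br (b j) z) =
      br (br (b i) (b j)) z + superSign k (par i) p • br (b j) (br (b i) z) := by
    intro j hj z
    have : br (b i) ∘ₗ br (b j) =
        br (br (b i) (b j)) + superSign k (par i) p • (br (b j) ∘ₗ br (b i)) :=
      b.ext fun l => key j hj l
    exact congrArg (fun F : M →ₗ[k] M => F z) this
  -- For fixed `z` the identity is a linear condition on the middle argument, so it passes from
  -- basis vectors of parity `p` to their span.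
  have hle : sector b par p ≤ LinearMap.ker (br (b i) ∘ₗ br.flip z - br.flip z ∘ₗ br (b i) -
      superSign k (par i) p • br.flip (br (b i) z)) := sector_le fun j hj => by
    simp [key2 j hj z]
  have := hle hy
  simp only [LinearMap.mem_ker, LinearMap.sub_apply, LinearMap.comp_apply,
    LinearMap.flip_apply, sub_sub, sub_eq_zero] at this
  exact this

theorem smul_basis_eq_bracket (hT : ∀ i j, br (b i) (b j) = eval k b (table i j)) {i j m : Idx}
    {c : ℤ} (h : isZeroList (table i j ++ [(m, -c)]) = true) :
    (c : k) • b m = br (b i) (b j) := by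
  have := eval_eq_zero (k := k) b h
  rw [eval_append, ← hT, eval_cons, eval_nil, add_zero, Int.cast_neg, neg_smul,
    ← sub_eq_add_neg, sub_eq_zero] at this
  exact this.symm

theorem intCast_ne_zero {c : ℤ} (hc : c % 5 ≠ 0) : (c : k) ≠ 0 := fun h =>
  hc (Int.emod_eq_zero_of_dvd ((CharP.intCast_eq_zero_iff k 5 c).1 h))

theorem isLieSuperalgebra_of_table (hT : ∀ i j, br (b i) (b j) = eval k b (table i j)) :
    IsLieSuperalgebra (sector b par) br := by
  have hmem := bracket_basis_mem_sector hT par_table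
  have hder : ∀ i, b i ∈ superDer (sector b par) br (par i) := by
    refine idx_induction (fun i t ht => basis_mem_superDer hT fun j l => jacobi_table_e i j l t ht)
      (fun i t ht => basis_mem_superDer hT fun j l => jacobi_table_f i j l t ht) ?_
    intro i j m c h hc hi hj
    have h1 := bracket_mem_superDer hmem hi hj
    rw [← smul_basis_eq_bracket hT h, Submodule.smul_mem_iff _ (intCast_ne_zero hc)] at h1
    -- The basis vector `b m` lies in the sector of parity `par i + par j`; its own coordinate is 1,
    -- so the labels agree.
    have h2 : par m = par i + par j := by
      by_contra hne
      have := repr_eq_zero_of_mem_sector h1.1 hne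
      simp at this
    rwa [h2]
  refine ⟨?_, hmem, ?_, ?_⟩
  · exact DirectSum.isInternal_submodule_iff_iSupIndep_and_iSup_eq_top _ |>.2
      ⟨iSupIndep_sector b par, iSup_sector b par⟩
  · intro p q x y hx hy
    rw [← sub_eq_zero, sub_neg_eq_add]
    refine (Submodule.mem_bot k).1 (bilin_mem_of_mem_sector
      (F := br + superSign k p q • br.flip) (S := ⊥) ?_ hx hy)
    rintro i j rfl rfl
    have := eval_eq_zero (k := k) b (anticomm_table i j)
    rw [eval_append, eval_smulList, ← hT, ← hT, ← superSign_par] at this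
    simpa using this
  · intro p q x y z hx hy
    exact (sector_le (S := superDer (sector b par) br p) (fun i hi => hi ▸ hder i) hx).2 q y hy z

/-- A nonzero component of nonzero degree would contain a basis vector, and multiplying this by its
opposite would give a nonzero element of `J` in degree 0. -/
theorem eq_bot_of_isTwoSidedIdeal (hT : ∀ i j, br (b i) (b j) = eval k b (table i j))
    (J : Submodule k M) (hJ : IsTwoSidedIdeal br J) (hgr : J = ⨆ d, J ⊓ sector b deg d)
    (h0 : J ⊓ sector b deg 0 = ⊥) : J = ⊥ := by
  refine hgr.trans (iSup_eq_bot.2 fun d => ?_)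
  by_cases hd : d = 0
  · rw [hd, h0]
  refine eq_bot_iff.2 fun x hx => (Submodule.mem_bot k).2 (by_contra fun hx0 => ?_)
  obtain ⟨i, hi⟩ : ∃ i, b.repr x i ≠ 0 := by
    by_contra! h
    exact hx0 (b.repr.map_eq_zero_iff.1 (Finsupp.ext h))
  obtain rfl : deg i = d := by
    by_contra h
    exact hi (repr_eq_zero_of_mem_sector hx.2 h)
  have hx' : x = b.repr x i • b i := by
    refine b.repr.injective (Finsupp.ext fun j => ?_)
    by_cases hj : deg j = deg i
    · obtain rfl := eq_of_deg_eq i j hd hj.symm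
      simp
    · have hne : i ≠ j := fun h => hj (h ▸ rfl)
      rw [repr_eq_zero_of_mem_sector hx.2 hj]
      simp [hne]
  have hbi : b i ∈ J := by
    have : x ∈ J := hx.1
    rwa [hx', Submodule.smul_mem_iff _ hi] at this
  obtain ⟨j, m, hj, hm⟩ := exists_opposite i hd
  have hz : br (b j) (b i) ∈ J ⊓ sector b deg 0 :=
    ⟨(hJ _ _ hbi).1, hj ▸ bracket_basis_mem_sector hT deg_table _ _ _ _
      (basis_mem_sector b deg j) (basis_mem_sector b deg i)⟩
  rw [h0, Submodule.mem_bot, hT] at hz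
  have := repr_eval b (table j i) m
  rw [hz] at this
  exact intCast_ne_zero hm (by simpa using this.symm)

open Contragredient

theorem bracket_chevalleyGen (hT : ∀ i j, br (b i) (b j) = eval k b (table i j)) (x y z : Gen 2)
    (c : ℤ) (h : isZeroList (mulList table (genList x) (genList y) ++
      smulList (-c) (genList z)) = true) :
    br (chevalleyGen b x) (chevalleyGen b y) = (c : k) • chevalleyGen b z := by
  have := eval_eq_zero (k := k) b h
  rw [eval_append, eval_smulList, ← map_eval_eval br hT] at this
  rw [← sub_eq_zero, ← this]
  push_cast
  simp only [chevalleyGen]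
  module

theorem isChevalley_chevalleyGen (hT : ∀ i j, br (b i) (b j) = eval k b (table i j)) :
    IsChevalley (br25Matrix k) br (chevalleyGen b) := by
  refine ⟨?_, ?_, ?_, ?_, ?_⟩
  · intro i j
    rw [bracket_chevalleyGen hT _ _ (.h 0) 0 (by revert i j; decide +kernel)]
    simp
  · intro i
    rw [bracket_chevalleyGen hT _ _ (.h i) 1 (by revert i; decide +kernel)]
    simp
  · intro i j hij
    rw [bracket_chevalleyGen hT _ _ (.h 0) 0 (by revert i j; decide +kernel)]
    simp
  · intro i j
    rw [bracket_chevalleyGen hT _ _ (.e j) (!![0, -1; -2, 1] i j) (by revert i j; decide +kernel)]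
    fin_cases i <;> fin_cases j <;> simp [br25Matrix]
  · intro i j
    rw [bracket_chevalleyGen hT _ _ (.f j) (-!![0, -1; -2, 1] i j) (by revert i j; decide +kernel)]
    fin_cases i <;> fin_cases j <;> simp [br25Matrix]

theorem superalgebraIso_of_table (hT : ∀ i j, br (b i) (b j) = eval k b (table i j)) :
    SuperalgebraIso (sector b par) br (br25Parity k) (br25Bracket k) := by
  refine superalgebraIso_alg (g := chevalleyGen b) (isLieSuperalgebra_of_table hT)
    (isChevalley_chevalleyGen hT) ?_ (sector b deg) (iSupIndep_sector b deg)
    (bracket_basis_mem_sector hT deg_table) ?_ ?_ ?_ (eq_bot_of_isTwoSidedIdeal hT)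
  · intro x
    refine chevalleyGen_mem_sector b x ?_
    rcases x with i | i | i <;> revert i <;> decide +kernel
  · intro x
    refine chevalleyGen_mem_sector b x ?_
    rcases x with i | i | i <;> revert i <;> decide +kernel
  · intro S hS hg
    rw [eq_top_iff, ← b.span_eq, Submodule.span_le]
    rintro _ ⟨i, rfl⟩
    revert i
    have hsingle : ∀ x t, genList x = [t] → t.2 % 5 ≠ 0 → b t.1 ∈ S := by
      intro x t hx hne
      have := hg x
      rwa [chevalleyGen, hx, eval_cons, eval_nil, add_zero,
        Submodule.smul_mem_iff _ (intCast_ne_zero hne)] at this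
    refine idx_induction ?_ ?_ ?_
    · intro i t ht
      fin_cases i <;> obtain rfl := List.mem_singleton.1 ht
      · exact hsingle (.e 0) _ rfl (by decide)
      · exact hsingle (.e 1) _ rfl (by decide)
    · intro i t ht
      fin_cases i <;> obtain rfl := List.mem_singleton.1 ht
      · exact hsingle (.f 0) _ rfl (by decide)
      · exact hsingle (.f 1) _ rfl (by decide)
    · intro i j m c h hc hi hj
      have := hS _ hi _ hj
      rwa [← smul_basis_eq_bracket hT h, Submodule.smul_mem_iff _ (intCast_ne_zero hc)] at this
  -- Here h₁ = -2H₁ - H₂ and h₂ = H₂, where H₁ and H₂ are the elements H of the two planes. The H₁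
  -- coordinate gives `c 0 = 0` as 2 ≠ 0 in `k`, then the H₂ coordinate gives `c 1 = 0`.
  · refine Fintype.linearIndependent_iff.2 fun c hc => ?_
    have h1 := congrArg (fun x => b.repr x (.inl (.inl 1))) hc
    have h2 := congrArg (fun x => b.repr x (.inl (.inr 1))) hc
    simp only [Fin.sum_univ_two, map_add, map_smul, Finsupp.add_apply, Finsupp.smul_apply,
      chevalleyGen, repr_eval, map_zero, Finsupp.zero_apply] at h1 h2
    have h11 : coeffList (.inl (.inl 1)) (genList (.h 0)) = -2 := by decide +kernel
    have h12 : coeffList (.inl (.inl 1)) (genList (.h 1)) = 0 := by decide +kernel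
    have h21 : coeffList (.inl (.inr 1)) (genList (.h 0)) = -1 := by decide +kernel
    have h22 : coeffList (.inl (.inr 1)) (genList (.h 1)) = 1 := by decide +kernel
    rw [h11, h12] at h1
    rw [h21, h22] at h2
    have h3 : (2 : k) ≠ 0 := by exact_mod_cast intCast_ne_zero (k := k) (c := 2) (by decide)
    have hc0 : c 0 = 0 := by simpa [h3] using h1
    have hc1 : c 1 = 0 := by simpa [hc0] using h2
    intro i
    fin_cases i
    · exact hc0
    · exact hc1

end Br25Table

end

noncomputable section

namespace Model

open Br25Table

/-! ### A symplectic plane in coordinates -/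

section OnePlane

variable {k : Type*} [Field k] {V : Type*} [AddCommGroup V] [Module k V]

theorem exists_symplectic_basis (hV : Module.finrank k V = 2) (B : LinearMap.BilinForm k V)
    (hB : B.IsAlt) (hB0 : B ≠ 0) :
    ∃ v : Module.Basis (Fin 2) k V, ∀ i j, B (v i) (v j) = (formT i j : k) := by
  obtain ⟨x, z, hxz⟩ : ∃ x z, B x z ≠ 0 := by
    by_contra! h
    exact hB0 (LinearMap.ext₂ h)
  set y := (B x z)⁻¹ • z with hy
  have hxy : B x y = 1 := by rw [hy, map_smul, smul_eq_mul, inv_mul_cancel₀ hxz]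
  have hyx : B y x = -1 := by rw [← LinearMap.IsAlt.neg hB x y, hxy]
  have hli : LinearIndependent k ![x, y] := by
    refine LinearIndependent.pair_iff.2 fun s t h => ?_
    have h1 := congrArg (B x) h
    have h2 := congrArg (B y) h
    simp [hB.self_eq_zero, hxy, hyx] at h1 h2
    exact ⟨h2, h1⟩
  refine ⟨basisOfLinearIndependentOfCardEqFinrank hli (by simp [hV]), fun i j => ?_⟩
  fin_cases i <;> fin_cases j <;> simp [formT, hB.self_eq_zero, hxy, hyx]

/-- The element `⟨a | ·⟩ a` of `𝔰𝔭(V)`. -/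
def transvection (B : LinearMap.BilinForm k V) (hB : B.IsAlt) (a : V) : Sp B :=
  ⟨(B a).smulRight a, by
    refine (LinearMap.mem_skewAdjointSubmodule _).mpr fun x y => ?_
    have h := (LinearMap.IsAlt.neg hB a x).symm
    simp only [LinearMap.smulRight_apply, map_smul, LinearMap.smul_apply, Pi.neg_apply,
      smul_eq_mul, map_neg]
    rw [h]
    ring⟩

theorem act_transvection (B : LinearMap.BilinForm k V) (hB : B.IsAlt) (a b : V) :
    act B (transvection B hB a) b = B a b • a := rfl

theorem act_gamma (B : LinearMap.BilinForm k V) (hB : B.IsAlt) (a b c : V) :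
    act B (gamma B hB a b) c = B a c • b + B b c • a := rfl

theorem act_ad (B : LinearMap.BilinForm k V) (f g : Sp B) (c : V) :
    act B (ad B f g) c = act B f (act B g c) - act B g (act B f c) := rfl

theorem form_act (B : LinearMap.BilinForm k V) (f : Sp B) (a b : V) :
    B (act B f a) b = -B a (act B f b) := by
  have := (LinearMap.mem_skewAdjointSubmodule _).mp f.2 a b
  rw [Pi.neg_apply, map_neg] at this
  exact this

theorem trForm_eq_sum (B : LinearMap.BilinForm k V) (v : Module.Basis (Fin 2) k V) (f g : Sp B) :
    trForm B f g = ∑ i, v.repr (act B f (act B g (v i))) i := by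
  change LinearMap.trace k V ((f : Module.End k V) * g) = _
  rw [LinearMap.trace_eq_matrix_trace k v, Matrix.trace]
  simp only [Matrix.diag_apply, LinearMap.toMatrix_apply]
  rfl

theorem sp_ext {B : LinearMap.BilinForm k V} (v : Module.Basis (Fin 2) k V) {f g : Sp B}
    (h : ∀ i, act B f (v i) = act B g (v i)) : f = g :=
  Subtype.ext (v.ext h)

/-- The elements `E, H, F` of `𝔰𝔭(V)` for a symplectic basis. -/
def spTriple (B : LinearMap.BilinForm k V) (hB : B.IsAlt) (v : Module.Basis (Fin 2) k V) :
    Fin 3 → Sp B :=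
  ![transvection B hB (v 0), -gamma B hB (v 0) (v 1), -transvection B hB (v 1)]

/-- Transvections ⟨a|·⟩a in place of γ_{a,a} = 2⟨a|·⟩a avoid a division by 2. The signs of H and F
come from ⟨v₁|v₀⟩ = -1. -/
theorem act_spTriple {B : LinearMap.BilinForm k V} (hB : B.IsAlt) {v : Module.Basis (Fin 2) k V}
    (hv : ∀ i j, B (v i) (v j) = (formT i j : k)) (i : Fin 3) (j : Fin 2) :
    act B (spTriple B hB v i) (v j) = eval k v (actT i j) := by
  fin_cases i <;> fin_cases j <;>
    simp [spTriple, actT, act_transvection, act_gamma, hv, formT]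

theorem exists_spTriple_basis {B : LinearMap.BilinForm k V} (hB : B.IsAlt)
    {v : Module.Basis (Fin 2) k V} (hv : ∀ i j, B (v i) (v j) = (formT i j : k)) :
    ∃ s : Module.Basis (Fin 3) k (Sp B), ∀ i j, act B (s i) (v j) = eval k v (actT i j) := by
  have hact := act_spTriple hB hv
  have hli : LinearIndependent k (spTriple B hB v) := by
    refine Fintype.linearIndependent_iff.2 fun c hc => ?_
    have h : ∀ j i, v.repr (act B (∑ i, c i • spTriple B hB v i) (v j)) i = 0 := fun j i => by
      rw [hc]; simp
    have h00 := h 0 0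
    have h01 := h 0 1
    have h10 := h 1 0
    simp [Fin.sum_univ_three, hact, actT] at h00 h01 h10
    intro i
    fin_cases i <;> assumption
  have hspan : ⊤ ≤ Submodule.span k (Set.range (spTriple B hB v)) := by
    intro f _
    have hf : f = v.repr (act B f (v 1)) 0 • spTriple B hB v 0 +
        v.repr (act B f (v 0)) 0 • spTriple B hB v 1 +
        v.repr (act B f (v 0)) 1 • spTriple B hB v 2 := by
      have hsum : ∀ w, w = v.repr w 0 • v 0 + v.repr w 1 • v 1 := fun w => by
        conv_lhs => rw [← v.sum_repr w, Fin.sum_univ_two]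
      -- Skew-adjointness on the pair (v₀, v₁) says that the trace is 0.
      have hsk : v.repr (act B f (v 1)) 1 = -v.repr (act B f (v 0)) 0 := by
        have h := form_act B f (v 0) (v 1)
        rw [hsum (act B f (v 0)), hsum (act B f (v 1))] at h
        simp [hv, formT] at h
        rw [h, neg_neg]
      refine sp_ext v fun j => ?_
      fin_cases j
      · conv_lhs => rw [Fin.zero_eta, hsum (act B f (v 0))]
        simp [hact, actT]
      · conv_lhs => rw [Fin.mk_one, hsum (act B f (v 1)), hsk]
        simp [hact, actT]
    rw [hf]
    refine add_mem (add_mem ?_ ?_) ?_ <;>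
      exact Submodule.smul_mem _ _ (Submodule.subset_span ⟨_, rfl⟩)
  refine ⟨Module.Basis.mk hli hspan, fun i j => ?_⟩
  rw [Module.Basis.mk_apply, hact]

/-- A symplectic basis `v` of a plane together with the basis `s = (E, H, F)` of `𝔰𝔭(V)`. -/
structure IsStandard (B : LinearMap.BilinForm k V) (v : Module.Basis (Fin 2) k V)
    (s : Module.Basis (Fin 3) k (Sp B)) : Prop where
  form (i j : Fin 2) : B (v i) (v j) = (formT i j : k)
  act (i : Fin 3) (j : Fin 2) : act B (s i) (v j) = eval k v (actT i j)

theorem exists_isStandard (hV : Module.finrank k V = 2) (B : LinearMap.BilinForm k V)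
    (hB : B.IsAlt) (hB0 : B ≠ 0) :
    ∃ (v : Module.Basis (Fin 2) k V) (s : Module.Basis (Fin 3) k (Sp B)), IsStandard B v s := by
  obtain ⟨v, hv⟩ := exists_symplectic_basis hV B hB hB0
  obtain ⟨s, hs⟩ := exists_spTriple_basis hB hv
  exact ⟨v, s, hv, hs⟩

namespace IsStandard

variable {B : LinearMap.BilinForm k V} {v : Module.Basis (Fin 2) k V}
  {s : Module.Basis (Fin 3) k (Sp B)}

theorem act_act (h : IsStandard B v s) (i j : Fin 3) (l : Fin 2) :
    Model.act B (s i) (Model.act B (s j) (v l)) = eval k v (mulList actT [(i, 1)] (actT j l)) := by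
  rw [h.act, ← map_eval_eval (Model.act B) h.act]
  simp

/-- Endomorphisms are compared by their action on `v`, which turns the claim into a check on `actT`
and `adT`. -/
theorem ad [CharP k 5] (h : IsStandard B v s) (i j : Fin 3) :
    Model.ad B (s i) (s j) = eval k s (adT i j) := by
  refine sp_ext v fun l => ?_
  have hz : isZeroList (mulList actT [(i, 1)] (actT j l) ++
      (smulList (-1) (mulList actT [(j, 1)] (actT i l)) ++
        smulList (-1) (mulList actT (adT i j) [(l, 1)]))) = true := by
    revert i j l; decide +kernel
  have := eval_eq_zero (k := k) v hz
  rw [eval_append, eval_append, eval_smulList, eval_smulList, ← h.act_act, ← h.act_act,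
    ← map_eval_eval (Model.act B) h.act] at this
  rw [act_ad, ← sub_eq_zero, ← this]
  simp
  abel

theorem gamma [CharP k 5] (h : IsStandard B v s) (hB : B.IsAlt) (i j : Fin 2) :
    Model.gamma B hB (v i) (v j) = eval k s (gammaT i j) := by
  refine sp_ext v fun l => ?_
  have hz : isZeroList ([(j, formT i l), (i, formT j l)] ++
      smulList (-1) (mulList actT (gammaT i j) [(l, 1)])) = true := by
    revert i j l; decide +kernel
  have := eval_eq_zero (k := k) v hz
  rw [eval_append, eval_smulList, ← map_eval_eval (Model.act B) h.act] at this
  rw [act_gamma, h.form, h.form, ← sub_eq_zero, ← this]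
  simp
  abel

theorem trForm (h : IsStandard B v s) (i j : Fin 3) :
    Model.trForm B (s i) (s j) = (trT i j : k) := by
  have hz : ∑ l, coeffList l (mulList actT [(i, 1)] (actT j l)) = trT i j := by
    revert i j; decide +kernel
  rw [trForm_eq_sum B v, ← hz, Int.cast_sum]
  exact Finset.sum_congr rfl fun l _ => by rw [h.act_act, repr_eval]

end IsStandard

end OnePlane

/-! ### The product on homogeneous pure tensors -/

section TwoPlanes

variable {k : Type*} [Field k] {V₁ V₂ : Type*} [AddCommGroup V₁] [Module k V₁]
  [AddCommGroup V₂] [Module k V₂] (B₁ : LinearMap.BilinForm k V₁) (B₂ : LinearMap.BilinForm k V₂)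

/-- The summand `𝔰𝔭(V₁)`. -/
def inS₁ : Sp B₁ →ₗ[k] Space B₁ B₂ := LinearMap.inl k _ _ ∘ₗ LinearMap.inl k _ _

/-- The summand `𝔰𝔭(V₂)`. -/
def inS₂ : Sp B₂ →ₗ[k] Space B₁ B₂ := LinearMap.inl k _ _ ∘ₗ LinearMap.inr k _ _

/-- The summand `𝔰𝔭(V₁) ⊗ V₂`. -/
def inX : (Sp B₁ ⊗[k] V₂) →ₗ[k] Space B₁ B₂ := LinearMap.inr k _ _ ∘ₗ LinearMap.inl k _ _

/-- The summand `V₁ ⊗ 𝔰𝔭(V₂)`. -/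
def inY : (V₁ ⊗[k] Sp B₂) →ₗ[k] Space B₁ B₂ :=
  LinearMap.inr k _ _ ∘ₗ LinearMap.inr k _ _ ∘ₗ LinearMap.inl k _ _

/-- The summand `V₁ ⊗ V₂`. -/
def inZ : (V₁ ⊗[k] V₂) →ₗ[k] Space B₁ B₂ :=
  LinearMap.inr k _ _ ∘ₗ LinearMap.inr k _ _ ∘ₗ LinearMap.inr k _ _

theorem inS₁_apply (f : Sp B₁) : inS₁ B₁ B₂ f = ((f, 0), 0, 0, 0) := rfl

theorem inS₂_apply (p : Sp B₂) : inS₂ B₁ B₂ p = ((0, p), 0, 0, 0) := rfl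

theorem inX_apply (x : Sp B₁ ⊗[k] V₂) : inX B₁ B₂ x = ((0, 0), x, 0, 0) := rfl

theorem inY_apply (y : V₁ ⊗[k] Sp B₂) : inY B₁ B₂ y = ((0, 0), 0, y, 0) := rfl

theorem inZ_apply (z : V₁ ⊗[k] V₂) : inZ B₁ B₂ z = ((0, 0), 0, 0, z) := rfl

variable {B₁ B₂} (h₁ : B₁.IsAlt) (h₂ : B₂.IsAlt)

theorem bracket_apply (X Y : Space B₁ B₂) : bracket h₁ h₂ X Y =
    ((ad B₁ X.1.1 Y.1.1, ad B₂ X.1.2 Y.1.2)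
        + mul1010 h₂ X.2.1 Y.2.1 + mul0101 h₁ X.2.2.1 Y.2.2.1 + mul1111 h₁ h₂ X.2.2.2 Y.2.2.2,
      tensorAct B₁ B₂ (ad B₁) (act B₂) X.1 Y.2.1 - tensorAct B₁ B₂ (ad B₁) (act B₂) Y.1 X.2.1
        + mul0111 B₂ h₁ X.2.2.1 Y.2.2.2 - mul0111 B₂ h₁ Y.2.2.1 X.2.2.2,
      tensorAct B₁ B₂ (act B₁) (ad B₂) X.1 Y.2.2.1
        - tensorAct B₁ B₂ (act B₁) (ad B₂) Y.1 X.2.2.1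
        + mul1011 B₁ h₂ X.2.1 Y.2.2.2 - mul1011 B₁ h₂ Y.2.1 X.2.2.2,
      tensorAct B₁ B₂ (act B₁) (act B₂) X.1 Y.2.2.2
        - tensorAct B₁ B₂ (act B₁) (act B₂) Y.1 X.2.2.2
        + mul1001 B₁ B₂ X.2.1 Y.2.2.1 + mul1001 B₁ B₂ Y.2.1 X.2.2.1) := rfl

theorem tensorAct_tmul {M₁ M₂ : Type*} [AddCommGroup M₁] [Module k M₁] [AddCommGroup M₂]
    [Module k M₂] (ρ₁ : Sp B₁ →ₗ[k] M₁ →ₗ[k] M₁) (ρ₂ : Sp B₂ →ₗ[k] M₂ →ₗ[k] M₂) (f : Sp B₁)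
    (p : Sp B₂) (x : M₁) (y : M₂) :
    tensorAct B₁ B₂ ρ₁ ρ₂ (f, p) (x ⊗ₜ y) = ρ₁ f x ⊗ₜ y + x ⊗ₜ ρ₂ p y := by
  simp [tensorAct]

theorem mul1010_tmul (f g : Sp B₁) (u v : V₂) : mul1010 h₂ (f ⊗ₜ u) (g ⊗ₜ v) =
    (B₂ u v • ad B₁ f g, (2 * trForm B₁ f g) • gamma B₂ h₂ u v) := by
  simp [mul1010, tensorLeft, tensorRight, mul_smul]

theorem mul0101_tmul (a b : V₁) (p q : Sp B₂) : mul0101 h₁ (a ⊗ₜ p) (b ⊗ₜ q) =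
    (-((2 * trForm B₂ p q) • gamma B₁ h₁ a b), -(B₁ a b • ad B₂ p q)) := by
  simp [mul0101, tensorLeft, tensorRight, mul_smul]

theorem mul1111_tmul (a b : V₁) (u v : V₂) : mul1111 h₁ h₂ (a ⊗ₜ u) (b ⊗ₜ v) =
    (B₂ u v • gamma B₁ h₁ a b, B₁ a b • gamma B₂ h₂ u v) := by
  simp [mul1111, tensorLeft, tensorRight]

theorem mul1001_tmul (f : Sp B₁) (u : V₂) (a : V₁) (p : Sp B₂) :
    mul1001 B₁ B₂ (f ⊗ₜ u) (a ⊗ₜ p) = act B₁ f a ⊗ₜ act B₂ p u := rfl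

theorem mul1011_tmul (f : Sp B₁) (u : V₂) (a : V₁) (v : V₂) :
    mul1011 B₁ h₂ (f ⊗ₜ u) (a ⊗ₜ v) = act B₁ f a ⊗ₜ gamma B₂ h₂ u v := rfl

theorem mul0111_tmul (a : V₁) (p : Sp B₂) (b : V₁) (v : V₂) :
    mul0111 B₂ h₁ (a ⊗ₜ p) (b ⊗ₜ v) = -(gamma B₁ h₁ a b ⊗ₜ act B₂ p v) := rfl

theorem bracket_inS₁_inS₁ (f g : Sp B₁) :
    bracket h₁ h₂ (inS₁ B₁ B₂ f) (inS₁ B₁ B₂ g) = inS₁ B₁ B₂ (ad B₁ f g) := by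
  simp [-map_zero, LinearMap.map_zero, inS₁_apply, bracket_apply]

theorem bracket_inS₂_inS₂ (p q : Sp B₂) :
    bracket h₁ h₂ (inS₂ B₁ B₂ p) (inS₂ B₁ B₂ q) = inS₂ B₁ B₂ (ad B₂ p q) := by
  simp [-map_zero, LinearMap.map_zero, inS₂_apply, bracket_apply]

theorem bracket_inS₁_inS₂ (f : Sp B₁) (p : Sp B₂) :
    bracket h₁ h₂ (inS₁ B₁ B₂ f) (inS₂ B₁ B₂ p) = 0 := by
  simp [-map_zero, LinearMap.map_zero, inS₁_apply, inS₂_apply, bracket_apply]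

theorem bracket_inS₂_inS₁ (f : Sp B₁) (p : Sp B₂) :
    bracket h₁ h₂ (inS₂ B₁ B₂ p) (inS₁ B₁ B₂ f) = 0 := by
  simp [-map_zero, LinearMap.map_zero, inS₂_apply, inS₁_apply, bracket_apply]

theorem bracket_inS₁_inX (f g : Sp B₁) (u : V₂) :
    bracket h₁ h₂ (inS₁ B₁ B₂ f) (inX B₁ B₂ (g ⊗ₜ u)) = inX B₁ B₂ (ad B₁ f g ⊗ₜ u) := by
  simp [-map_zero, LinearMap.map_zero, inS₁_apply, inX_apply, bracket_apply, tensorAct_tmul]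

theorem bracket_inX_inS₁ (f g : Sp B₁) (u : V₂) :
    bracket h₁ h₂ (inX B₁ B₂ (g ⊗ₜ u)) (inS₁ B₁ B₂ f) = -inX B₁ B₂ (ad B₁ f g ⊗ₜ u) := by
  simp [-map_zero, LinearMap.map_zero, inX_apply, inS₁_apply, bracket_apply, tensorAct_tmul]

theorem bracket_inS₁_inY (f : Sp B₁) (a : V₁) (p : Sp B₂) :
    bracket h₁ h₂ (inS₁ B₁ B₂ f) (inY B₁ B₂ (a ⊗ₜ p)) = inY B₁ B₂ (act B₁ f a ⊗ₜ p) := by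
  simp [-map_zero, LinearMap.map_zero, inS₁_apply, inY_apply, bracket_apply, tensorAct_tmul]

theorem bracket_inY_inS₁ (f : Sp B₁) (a : V₁) (p : Sp B₂) :
    bracket h₁ h₂ (inY B₁ B₂ (a ⊗ₜ p)) (inS₁ B₁ B₂ f) = -inY B₁ B₂ (act B₁ f a ⊗ₜ p) := by
  simp [-map_zero, LinearMap.map_zero, inY_apply, inS₁_apply, bracket_apply, tensorAct_tmul]

theorem bracket_inS₁_inZ (f : Sp B₁) (a : V₁) (u : V₂) :
    bracket h₁ h₂ (inS₁ B₁ B₂ f) (inZ B₁ B₂ (a ⊗ₜ u)) = inZ B₁ B₂ (act B₁ f a ⊗ₜ u) := by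
  simp [-map_zero, LinearMap.map_zero, inS₁_apply, inZ_apply, bracket_apply, tensorAct_tmul]

theorem bracket_inZ_inS₁ (f : Sp B₁) (a : V₁) (u : V₂) :
    bracket h₁ h₂ (inZ B₁ B₂ (a ⊗ₜ u)) (inS₁ B₁ B₂ f) = -inZ B₁ B₂ (act B₁ f a ⊗ₜ u) := by
  simp [-map_zero, LinearMap.map_zero, inZ_apply, inS₁_apply, bracket_apply, tensorAct_tmul]

theorem bracket_inS₂_inX (p : Sp B₂) (f : Sp B₁) (u : V₂) :
    bracket h₁ h₂ (inS₂ B₁ B₂ p) (inX B₁ B₂ (f ⊗ₜ u)) = inX B₁ B₂ (f ⊗ₜ act B₂ p u) := by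
  simp [-map_zero, LinearMap.map_zero, inS₂_apply, inX_apply, bracket_apply, tensorAct_tmul]

theorem bracket_inX_inS₂ (p : Sp B₂) (f : Sp B₁) (u : V₂) :
    bracket h₁ h₂ (inX B₁ B₂ (f ⊗ₜ u)) (inS₂ B₁ B₂ p) = -inX B₁ B₂ (f ⊗ₜ act B₂ p u) := by
  simp [-map_zero, LinearMap.map_zero, inX_apply, inS₂_apply, bracket_apply, tensorAct_tmul]

theorem bracket_inS₂_inY (p q : Sp B₂) (a : V₁) :
    bracket h₁ h₂ (inS₂ B₁ B₂ p) (inY B₁ B₂ (a ⊗ₜ q)) = inY B₁ B₂ (a ⊗ₜ ad B₂ p q) := by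
  simp [-map_zero, LinearMap.map_zero, inS₂_apply, inY_apply, bracket_apply, tensorAct_tmul]

theorem bracket_inY_inS₂ (p q : Sp B₂) (a : V₁) :
    bracket h₁ h₂ (inY B₁ B₂ (a ⊗ₜ q)) (inS₂ B₁ B₂ p) = -inY B₁ B₂ (a ⊗ₜ ad B₂ p q) := by
  simp [-map_zero, LinearMap.map_zero, inY_apply, inS₂_apply, bracket_apply, tensorAct_tmul]

theorem bracket_inS₂_inZ (p : Sp B₂) (a : V₁) (u : V₂) :
    bracket h₁ h₂ (inS₂ B₁ B₂ p) (inZ B₁ B₂ (a ⊗ₜ u)) = inZ B₁ B₂ (a ⊗ₜ act B₂ p u) := by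
  simp [-map_zero, LinearMap.map_zero, inS₂_apply, inZ_apply, bracket_apply, tensorAct_tmul]

theorem bracket_inZ_inS₂ (p : Sp B₂) (a : V₁) (u : V₂) :
    bracket h₁ h₂ (inZ B₁ B₂ (a ⊗ₜ u)) (inS₂ B₁ B₂ p) = -inZ B₁ B₂ (a ⊗ₜ act B₂ p u) := by
  simp [-map_zero, LinearMap.map_zero, inZ_apply, inS₂_apply, bracket_apply, tensorAct_tmul]

theorem bracket_inX_inX (f g : Sp B₁) (u v : V₂) :
    bracket h₁ h₂ (inX B₁ B₂ (f ⊗ₜ u)) (inX B₁ B₂ (g ⊗ₜ v)) = B₂ u v • inS₁ B₁ B₂ (ad B₁ f g) +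
      (2 * trForm B₁ f g) • inS₂ B₁ B₂ (gamma B₂ h₂ u v) := by
  simp [-map_zero, LinearMap.map_zero, inX_apply, inS₁_apply, inS₂_apply, bracket_apply, mul1010_tmul, tensorAct_tmul]

theorem bracket_inY_inY (a b : V₁) (p q : Sp B₂) :
    bracket h₁ h₂ (inY B₁ B₂ (a ⊗ₜ p)) (inY B₁ B₂ (b ⊗ₜ q)) = -(2 * trForm B₂ p q) • inS₁ B₁ B₂ (gamma B₁ h₁ a b) +
      (-B₁ a b) • inS₂ B₁ B₂ (ad B₂ p q) := by
  simp [-map_zero, LinearMap.map_zero, inY_apply, inS₁_apply, inS₂_apply, bracket_apply, mul0101_tmul, tensorAct_tmul]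

theorem bracket_inZ_inZ (a b : V₁) (u v : V₂) :
    bracket h₁ h₂ (inZ B₁ B₂ (a ⊗ₜ u)) (inZ B₁ B₂ (b ⊗ₜ v)) = B₂ u v • inS₁ B₁ B₂ (gamma B₁ h₁ a b) +
      B₁ a b • inS₂ B₁ B₂ (gamma B₂ h₂ u v) := by
  simp [-map_zero, LinearMap.map_zero, inZ_apply, inS₁_apply, inS₂_apply, bracket_apply, mul1111_tmul, tensorAct_tmul]

theorem bracket_inX_inY (f : Sp B₁) (u : V₂) (a : V₁) (p : Sp B₂) :
    bracket h₁ h₂ (inX B₁ B₂ (f ⊗ₜ u)) (inY B₁ B₂ (a ⊗ₜ p)) = inZ B₁ B₂ (act B₁ f a ⊗ₜ act B₂ p u) := by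
  simp [-map_zero, LinearMap.map_zero, inX_apply, inY_apply, inZ_apply, bracket_apply, mul1001_tmul, tensorAct_tmul]

theorem bracket_inY_inX (f : Sp B₁) (u : V₂) (a : V₁) (p : Sp B₂) :
    bracket h₁ h₂ (inY B₁ B₂ (a ⊗ₜ p)) (inX B₁ B₂ (f ⊗ₜ u)) = inZ B₁ B₂ (act B₁ f a ⊗ₜ act B₂ p u) := by
  simp [-map_zero, LinearMap.map_zero, inY_apply, inX_apply, inZ_apply, bracket_apply, mul1001_tmul, tensorAct_tmul]

theorem bracket_inX_inZ (f : Sp B₁) (a : V₁) (u v : V₂) :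
    bracket h₁ h₂ (inX B₁ B₂ (f ⊗ₜ u)) (inZ B₁ B₂ (a ⊗ₜ v)) = inY B₁ B₂ (act B₁ f a ⊗ₜ gamma B₂ h₂ u v) := by
  simp [-map_zero, LinearMap.map_zero, inX_apply, inZ_apply, inY_apply, bracket_apply, mul1011_tmul, tensorAct_tmul]

theorem bracket_inZ_inX (f : Sp B₁) (a : V₁) (u v : V₂) :
    bracket h₁ h₂ (inZ B₁ B₂ (a ⊗ₜ v)) (inX B₁ B₂ (f ⊗ₜ u)) = -inY B₁ B₂ (act B₁ f a ⊗ₜ gamma B₂ h₂ u v) := by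
  simp [-map_zero, LinearMap.map_zero, inZ_apply, inX_apply, inY_apply, bracket_apply, mul1011_tmul, tensorAct_tmul]

theorem bracket_inY_inZ (a b : V₁) (p : Sp B₂) (v : V₂) :
    bracket h₁ h₂ (inY B₁ B₂ (a ⊗ₜ p)) (inZ B₁ B₂ (b ⊗ₜ v)) = -inX B₁ B₂ (gamma B₁ h₁ a b ⊗ₜ act B₂ p v) := by
  simp [-map_zero, LinearMap.map_zero, inY_apply, inZ_apply, inX_apply, bracket_apply, mul0111_tmul, tensorAct_tmul]

theorem bracket_inZ_inY (a b : V₁) (p : Sp B₂) (v : V₂) :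
    bracket h₁ h₂ (inZ B₁ B₂ (b ⊗ₜ v)) (inY B₁ B₂ (a ⊗ₜ p)) = inX B₁ B₂ (gamma B₁ h₁ a b ⊗ₜ act B₂ p v) := by
  simp [-map_zero, LinearMap.map_zero, inZ_apply, inY_apply, inX_apply, bracket_apply, mul0111_tmul, tensorAct_tmul]

end TwoPlanes


end Model
end

/-! ### The model in coordinates -/

noncomputable section
namespace Model
open Br25Table
section Coordinates

variable {k : Type*} [Field k] {V₁ V₂ : Type*} [AddCommGroup V₁] [Module k V₁]
  [AddCommGroup V₂] [Module k V₂] {B₁ : LinearMap.BilinForm k V₁} {B₂ : LinearMap.BilinForm k V₂}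
  (v₁ : Module.Basis (Fin 2) k V₁) (s₁ : Module.Basis (Fin 3) k (Sp B₁))
  (v₂ : Module.Basis (Fin 2) k V₂) (s₂ : Module.Basis (Fin 3) k (Sp B₂))

/-- The homogeneous basis of the model. -/
def spaceBasis : Module.Basis Idx k (Space B₁ B₂) :=
  (s₁.prod s₂).prod ((s₁.tensorProduct v₂).prod
    ((v₁.tensorProduct s₂).prod (v₁.tensorProduct v₂)))

theorem spaceBasis_S₁ (i : Fin 3) :
    spaceBasis v₁ s₁ v₂ s₂ (.inl (.inl i)) = inS₁ B₁ B₂ (s₁ i) := by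
  simp [spaceBasis, inS₁]

theorem spaceBasis_S₂ (i : Fin 3) :
    spaceBasis v₁ s₁ v₂ s₂ (.inl (.inr i)) = inS₂ B₁ B₂ (s₂ i) := by
  simp [spaceBasis, inS₂]

theorem spaceBasis_X (p : Fin 3 × Fin 2) :
    spaceBasis v₁ s₁ v₂ s₂ (.inr (.inl p)) = inX B₁ B₂ (s₁ p.1 ⊗ₜ v₂ p.2) := by
  simp [spaceBasis, inX, Module.Basis.tensorProduct_apply']

theorem spaceBasis_Y (p : Fin 2 × Fin 3) :
    spaceBasis v₁ s₁ v₂ s₂ (.inr (.inr (.inl p))) = inY B₁ B₂ (v₁ p.1 ⊗ₜ s₂ p.2) := by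
  simp [spaceBasis, inY, Module.Basis.tensorProduct_apply']

theorem spaceBasis_Z (p : Fin 2 × Fin 2) :
    spaceBasis v₁ s₁ v₂ s₂ (.inr (.inr (.inr p))) = inZ B₁ B₂ (v₁ p.1 ⊗ₜ v₂ p.2) := by
  simp [spaceBasis, inZ, Module.Basis.tensorProduct_apply']

theorem eq_zero_iff_repr {k ι W : Type*} [Field k] [AddCommGroup W] [Module k W]
    (b : Module.Basis ι k W) (w : W) : w = 0 ↔ ∀ i, b.repr w i = 0 := by
  rw [← b.repr.map_eq_zero_iff, Finsupp.ext_iff]; rfl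

theorem parity_eq_sector (p : ZMod 2) :
    parity B₁ B₂ p = sector (spaceBasis v₁ s₁ v₂ s₂) par p := by
  ext ⟨⟨f, g⟩, x, y, z⟩
  rw [mem_sector]
  have hp : p = 0 ∨ p = 1 := by revert p; decide
  simp only [spaceBasis]
  -- Parity sees only the summand, so any bases of the tensor products will do; opaque ones keep
  -- `simp` from expanding them.
  generalize s₁.tensorProduct v₂ = bX
  generalize v₁.tensorProduct s₂ = bY
  generalize v₁.tensorProduct v₂ = bZ
  rcases hp with rfl | rfl
  · rw [Sum.forall, Sum.forall, Sum.forall]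
    simp [parity, Submodule.mem_prod, par, eq_zero_iff_repr bX, eq_zero_iff_repr bY]
  · rw [Sum.forall, Sum.forall, Sum.forall, Sum.forall]
    simp [parity, Submodule.mem_prod, par, eq_zero_iff_repr bZ, eq_zero_iff_repr s₁, eq_zero_iff_repr s₂]

variable {v₁ s₁ v₂ s₂} [CharP k 5]

theorem bracket_spaceBasis (H₁ : IsStandard B₁ v₁ s₁) (H₂ : IsStandard B₂ v₂ s₂)
    (h₁ : B₁.IsAlt) (h₂ : B₂.IsAlt) (i j : Idx) :
    bracket h₁ h₂ (spaceBasis v₁ s₁ v₂ s₂ i) (spaceBasis v₁ s₁ v₂ s₂ j) =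
      eval k (spaceBasis v₁ s₁ v₂ s₂) (table i j) := by
  -- These rules pull the inclusions and one tensor factor out of `eval`. Each entry of the table
  -- then takes the shape of a product formula on pure tensors, in all 25 pairs of summands.
  have e1 : ∀ l, eval k (fun m => inS₁ B₁ B₂ (s₁ m)) l = inS₁ B₁ B₂ (eval k s₁ l) :=
    fun l => (map_eval _ _ _).symm
  have e2 : ∀ l, eval k (fun m => inS₂ B₁ B₂ (s₂ m)) l = inS₂ B₁ B₂ (eval k s₂ l) :=
    fun l => (map_eval _ _ _).symm
  have x1 : ∀ l u, eval k (fun m => inX B₁ B₂ (s₁ m ⊗ₜ u)) l = inX B₁ B₂ (eval k s₁ l ⊗ₜ u) :=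
    fun l u => (map_eval (inX B₁ B₂ ∘ₗ (TensorProduct.mk k _ _).flip u) _ _).symm
  have x2 : ∀ l f, eval k (fun m => inX B₁ B₂ (f ⊗ₜ v₂ m)) l = inX B₁ B₂ (f ⊗ₜ eval k v₂ l) :=
    fun l f => (map_eval (inX B₁ B₂ ∘ₗ TensorProduct.mk k _ _ f) _ _).symm
  have x3 : ∀ l, eval k (fun p : Fin 3 × Fin 2 => inX B₁ B₂ (s₁ p.1 ⊗ₜ v₂ p.2)) l =
      inX B₁ B₂ (eval k (fun p : Fin 3 × Fin 2 => s₁ p.1 ⊗ₜ[k] v₂ p.2) l) :=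
    fun l => (map_eval _ _ _).symm
  have y1 : ∀ l u, eval k (fun m => inY B₁ B₂ (v₁ m ⊗ₜ u)) l = inY B₁ B₂ (eval k v₁ l ⊗ₜ u) :=
    fun l u => (map_eval (inY B₁ B₂ ∘ₗ (TensorProduct.mk k _ _).flip u) _ _).symm
  have y2 : ∀ l f, eval k (fun m => inY B₁ B₂ (f ⊗ₜ s₂ m)) l = inY B₁ B₂ (f ⊗ₜ eval k s₂ l) :=
    fun l f => (map_eval (inY B₁ B₂ ∘ₗ TensorProduct.mk k _ _ f) _ _).symm
  have y3 : ∀ l, eval k (fun p : Fin 2 × Fin 3 => inY B₁ B₂ (v₁ p.1 ⊗ₜ s₂ p.2)) l =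
      inY B₁ B₂ (eval k (fun p : Fin 2 × Fin 3 => v₁ p.1 ⊗ₜ[k] s₂ p.2) l) :=
    fun l => (map_eval _ _ _).symm
  have z1 : ∀ l u, eval k (fun m => inZ B₁ B₂ (v₁ m ⊗ₜ u)) l = inZ B₁ B₂ (eval k v₁ l ⊗ₜ u) :=
    fun l u => (map_eval (inZ B₁ B₂ ∘ₗ (TensorProduct.mk k _ _).flip u) _ _).symm
  have z2 : ∀ l f, eval k (fun m => inZ B₁ B₂ (f ⊗ₜ v₂ m)) l = inZ B₁ B₂ (f ⊗ₜ eval k v₂ l) :=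
    fun l f => (map_eval (inZ B₁ B₂ ∘ₗ TensorProduct.mk k _ _ f) _ _).symm
  have z3 : ∀ l, eval k (fun p : Fin 2 × Fin 2 => inZ B₁ B₂ (v₁ p.1 ⊗ₜ v₂ p.2)) l =
      inZ B₁ B₂ (eval k (fun p : Fin 2 × Fin 2 => v₁ p.1 ⊗ₜ[k] v₂ p.2) l) :=
    fun l => (map_eval _ _ _).symm
  rcases i with (i | i) | ⟨i, i'⟩ | ⟨i, i'⟩ | ⟨i, i'⟩ <;>
    rcases j with (j | j) | ⟨j, j'⟩ | ⟨j, j'⟩ | ⟨j, j'⟩ <;>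
    simp only [table, eval_reindex, eval_append, eval_smulList, eval_nil, spaceBasis_S₁,
      spaceBasis_S₂, spaceBasis_X, spaceBasis_Y, spaceBasis_Z, e1, e2, x1, x2, x3, y1, y2, y3, z1,
      z2, z3, eval_tensorList, ← H₁.act, ← H₁.ad, ← H₁.gamma h₁, ← H₂.act, ← H₂.ad,
      ← H₂.gamma h₂, bracket_inS₁_inS₁, bracket_inS₂_inS₂, bracket_inS₁_inS₂, bracket_inS₂_inS₁, bracket_inS₁_inX, bracket_inX_inS₁, bracket_inS₁_inY, bracket_inY_inS₁, bracket_inS₁_inZ, bracket_inZ_inS₁, bracket_inS₂_inX, bracket_inX_inS₂, bracket_inS₂_inY, bracket_inY_inS₂, bracket_inS₂_inZ, bracket_inZ_inS₂, bracket_inX_inX, bracket_inY_inY, bracket_inZ_inZ, bracket_inX_inY, bracket_inY_inX, bracket_inX_inZ, bracket_inZ_inX, bracket_inY_inZ, bracket_inZ_inY, Int.cast_neg, Int.cast_one, neg_smul, one_smul, Int.cast_mul, Int.cast_ofNat,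
      H₁.form, H₂.form, H₁.trForm, H₂.trForm]

end Coordinates

end Model

end

/-! ### The even part as 𝔰𝔭(V₁ ⊥ V₂) -/

noncomputable section
namespace Model
open Br25Table

section EvenPart

variable {k : Type*} [Field k] {V₁ V₂ : Type*} [AddCommGroup V₁] [Module k V₁]
  [AddCommGroup V₂] [Module k V₂] {B₁ : LinearMap.BilinForm k V₁} {B₂ : LinearMap.BilinForm k V₂}

theorem orthSum_apply (x y : V₁ × V₂) : orthSum B₁ B₂ x y = B₁ x.1 y.1 + B₂ x.2 y.2 := rfl

theorem isAlt_orthSum (h₁ : B₁.IsAlt) (h₂ : B₂.IsAlt) : (orthSum B₁ B₂).IsAlt := fun x => by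
  rw [orthSum_apply, h₁.self_eq_zero, h₂.self_eq_zero, add_zero]

variable (B₁ B₂) in
/-- The block diagonal embedding of `𝔰𝔭(V₁)` in `𝔰𝔭(V₁ ⊥ V₂)`. -/
def diagLeft : Sp B₁ →ₗ[k] Sp (orthSum B₁ B₂) where
  toFun f := ⟨LinearMap.inl k V₁ V₂ ∘ₗ act B₁ f ∘ₗ LinearMap.fst k V₁ V₂, by
    refine (LinearMap.mem_skewAdjointSubmodule _).mpr fun x y => ?_
    simp [orthSum_apply, form_act]⟩
  map_add' f g := by ext <;> simp
  map_smul' c f := by ext <;> simp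

variable (B₁ B₂) in
/-- The block diagonal embedding of `𝔰𝔭(V₂)` in `𝔰𝔭(V₁ ⊥ V₂)`. -/
def diagRight : Sp B₂ →ₗ[k] Sp (orthSum B₁ B₂) where
  toFun f := ⟨LinearMap.inr k V₁ V₂ ∘ₗ act B₂ f ∘ₗ LinearMap.snd k V₁ V₂, by
    refine (LinearMap.mem_skewAdjointSubmodule _).mpr fun x y => ?_
    simp [orthSum_apply, form_act]⟩
  map_add' f g := by ext <;> simp
  map_smul' c f := by ext <;> simp

/-- The off-diagonal embedding `a ⊗ u ↦ γ_{a,u}` of `V₁ ⊗ V₂` in `𝔰𝔭(V₁ ⊥ V₂)`. -/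
def offDiag (h₁ : B₁.IsAlt) (h₂ : B₂.IsAlt) : (V₁ ⊗[k] V₂) →ₗ[k] Sp (orthSum B₁ B₂) :=
  TensorProduct.lift ((gamma (orthSum B₁ B₂) (isAlt_orthSum h₁ h₂)).compl₁₂
    (LinearMap.inl k V₁ V₂) (LinearMap.inr k V₁ V₂))

theorem act_diagLeft (f : Sp B₁) (x : V₁ × V₂) :
    act (orthSum B₁ B₂) (diagLeft B₁ B₂ f) x = (act B₁ f x.1, 0) := rfl

theorem act_diagRight (p : Sp B₂) (x : V₁ × V₂) :
    act (orthSum B₁ B₂) (diagRight B₁ B₂ p) x = (0, act B₂ p x.2) := rfl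

theorem act_offDiag (h₁ : B₁.IsAlt) (h₂ : B₂.IsAlt) (a : V₁) (u : V₂) (x : V₁ × V₂) :
    act (orthSum B₁ B₂) (offDiag h₁ h₂ (a ⊗ₜ u)) x = (B₂ u x.2 • a, B₁ a x.1 • u) := by
  rw [offDiag, TensorProduct.lift.tmul, LinearMap.compl₁₂_apply, act_gamma]
  simp [orthSum_apply]

theorem sp_ext_apply {V : Type*} [AddCommGroup V] [Module k V] {B : LinearMap.BilinForm k V}
    {f g : Sp B} (h : ∀ x, act B f x = act B g x) : f = g :=
  Subtype.ext (LinearMap.ext h)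

theorem ad_skew {V : Type*} [AddCommGroup V] [Module k V] (B : LinearMap.BilinForm k V)
    (f g : Sp B) : ad B f g = -ad B g f :=
  (lie_skew f g).symm

theorem ad_diagLeft_diagLeft (f g : Sp B₁) :
    ad _ (diagLeft B₁ B₂ f) (diagLeft B₁ B₂ g) = diagLeft B₁ B₂ (ad B₁ f g) :=
  sp_ext_apply fun x => by simp [act_ad, act_diagLeft]

theorem ad_diagRight_diagRight (p q : Sp B₂) :
    ad _ (diagRight B₁ B₂ p) (diagRight B₁ B₂ q) = diagRight B₁ B₂ (ad B₂ p q) :=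
  sp_ext_apply fun x => by simp [act_ad, act_diagRight]

theorem ad_diagLeft_diagRight (f : Sp B₁) (p : Sp B₂) :
    ad _ (diagLeft B₁ B₂ f) (diagRight B₁ B₂ p) = 0 :=
  sp_ext_apply fun x => by simp [act_ad, act_diagLeft, act_diagRight]

theorem ad_diagLeft_offDiag (h₁ : B₁.IsAlt) (h₂ : B₂.IsAlt) (f : Sp B₁) (a : V₁) (u : V₂) :
    ad _ (diagLeft B₁ B₂ f) (offDiag h₁ h₂ (a ⊗ₜ u)) = offDiag h₁ h₂ (act B₁ f a ⊗ₜ u) :=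
  sp_ext_apply fun x => by simp [act_ad, act_diagLeft, act_offDiag, form_act]

theorem ad_diagRight_offDiag (h₁ : B₁.IsAlt) (h₂ : B₂.IsAlt) (p : Sp B₂) (a : V₁) (u : V₂) :
    ad _ (diagRight B₁ B₂ p) (offDiag h₁ h₂ (a ⊗ₜ u)) = offDiag h₁ h₂ (a ⊗ₜ act B₂ p u) :=
  sp_ext_apply fun x => by simp [act_ad, act_diagRight, act_offDiag, form_act]

/-- Two off-diagonal maps compose to a block diagonal one, and the commutator reproduces the product
prescribed on V₁ ⊗ V₂. -/
theorem ad_offDiag_offDiag (h₁ : B₁.IsAlt) (h₂ : B₂.IsAlt) (a b : V₁) (u v : V₂) :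
    ad _ (offDiag h₁ h₂ (a ⊗ₜ u)) (offDiag h₁ h₂ (b ⊗ₜ v)) =
      B₂ u v • diagLeft B₁ B₂ (gamma B₁ h₁ a b) + B₁ a b • diagRight B₁ B₂ (gamma B₂ h₂ u v) :=
  sp_ext_apply fun x => by
    -- The two composites bring in the forms with both orders of arguments; these identities reduce
    -- them to one order.
    have e₁ := LinearMap.IsAlt.neg h₁ a b
    have e₂ := LinearMap.IsAlt.neg h₂ u v
    simp only [act_ad, act_offDiag, map_add, map_smul, LinearMap.add_apply, LinearMap.smul_apply,
      act_diagLeft, act_diagRight, act_gamma, ← e₁, ← e₂]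
    ext
    · simp [smul_smul]
      module
    · simp [smul_smul]
      module

/-- The map to `𝔰𝔭(V₁ ⊥ V₂)`, zero on the odd part. -/
def toSp (h₁ : B₁.IsAlt) (h₂ : B₂.IsAlt) : Space B₁ B₂ →ₗ[k] Sp (orthSum B₁ B₂) :=
  LinearMap.coprod (LinearMap.coprod (diagLeft B₁ B₂) (diagRight B₁ B₂))
    (LinearMap.coprod 0 (LinearMap.coprod 0 (offDiag h₁ h₂)))

theorem toSp_apply (h₁ : B₁.IsAlt) (h₂ : B₂.IsAlt) (X : Space B₁ B₂) :
    toSp h₁ h₂ X = diagLeft B₁ B₂ X.1.1 + diagRight B₁ B₂ X.1.2 + offDiag h₁ h₂ X.2.2.2 := by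
  simp [toSp]

theorem toSp_inS₁ (h₁ : B₁.IsAlt) (h₂ : B₂.IsAlt) (f : Sp B₁) :
    toSp h₁ h₂ (inS₁ B₁ B₂ f) = diagLeft B₁ B₂ f := by
  simp [toSp_apply, inS₁_apply]

theorem toSp_inS₂ (h₁ : B₁.IsAlt) (h₂ : B₂.IsAlt) (p : Sp B₂) :
    toSp h₁ h₂ (inS₂ B₁ B₂ p) = diagRight B₁ B₂ p := by
  simp [toSp_apply, inS₂_apply]

theorem toSp_inZ (h₁ : B₁.IsAlt) (h₂ : B₂.IsAlt) (z : V₁ ⊗[k] V₂) :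
    toSp h₁ h₂ (inZ B₁ B₂ z) = offDiag h₁ h₂ z := by
  simp [toSp_apply, inZ_apply]

theorem mem_parity_zero {X : Space B₁ B₂} :
    X ∈ parity B₁ B₂ 0 ↔ X.2.1 = 0 ∧ X.2.2.1 = 0 := by
  simp [parity, Submodule.mem_prod]

theorem eq_sum_of_mem_parity_zero {X : Space B₁ B₂} (hX : X ∈ parity B₁ B₂ 0) :
    X = inS₁ B₁ B₂ X.1.1 + inS₂ B₁ B₂ X.1.2 + inZ B₁ B₂ X.2.2.2 := by
  obtain ⟨⟨f, p⟩, x, y, z⟩ := X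
  obtain ⟨rfl, rfl⟩ : x = 0 ∧ y = 0 := mem_parity_zero.1 hX
  simp [inS₁_apply, inS₂_apply, inZ_apply]

theorem toSp_bracket (h₁ : B₁.IsAlt) (h₂ : B₂.IsAlt) {X Y : Space B₁ B₂} (hX : X ∈ parity B₁ B₂ 0)
    (hY : Y ∈ parity B₁ B₂ 0) :
    toSp h₁ h₂ (bracket h₁ h₂ X Y) = ad _ (toSp h₁ h₂ X) (toSp h₁ h₂ Y) := by
  rw [eq_sum_of_mem_parity_zero hX, eq_sum_of_mem_parity_zero hY]
  generalize X.1.1 = f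
  generalize X.1.2 = p
  generalize X.2.2.2 = z
  generalize Y.1.1 = g
  generalize Y.1.2 = q
  generalize Y.2.2.2 = w
  have hSZ : ∀ (f : Sp B₁) (z : V₁ ⊗[k] V₂), toSp h₁ h₂ (bracket h₁ h₂ (inS₁ B₁ B₂ f) (inZ B₁ B₂ z)) =
      ad _ (diagLeft B₁ B₂ f) (offDiag h₁ h₂ z) := fun f z => by
    induction z with
    | zero => simp only [LinearMap.map_zero]
    | tmul a u => rw [bracket_inS₁_inZ, toSp_inZ, ad_diagLeft_offDiag]
    | add z z' h h' => simp only [LinearMap.map_add, h, h']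
  have hSZ' : ∀ (p : Sp B₂) (z : V₁ ⊗[k] V₂), toSp h₁ h₂ (bracket h₁ h₂ (inS₂ B₁ B₂ p) (inZ B₁ B₂ z)) =
      ad _ (diagRight B₁ B₂ p) (offDiag h₁ h₂ z) := fun p z => by
    induction z with
    | zero => simp only [LinearMap.map_zero]
    | tmul a u => rw [bracket_inS₂_inZ, toSp_inZ, ad_diagRight_offDiag]
    | add z z' h h' => simp only [LinearMap.map_add, h, h']
  have hZS : ∀ (f : Sp B₁) (z : V₁ ⊗[k] V₂), toSp h₁ h₂ (bracket h₁ h₂ (inZ B₁ B₂ z) (inS₁ B₁ B₂ f)) =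
      ad _ (offDiag h₁ h₂ z) (diagLeft B₁ B₂ f) := fun f z => by
    induction z with
    | zero => simp only [LinearMap.map_zero, LinearMap.zero_apply]
    | tmul a u => rw [bracket_inZ_inS₁, LinearMap.map_neg, toSp_inZ, ad_skew, ad_diagLeft_offDiag]
    | add z z' h h' => simp only [LinearMap.map_add, LinearMap.add_apply, h, h']
  have hZS' : ∀ (p : Sp B₂) (z : V₁ ⊗[k] V₂), toSp h₁ h₂ (bracket h₁ h₂ (inZ B₁ B₂ z) (inS₂ B₁ B₂ p)) =
      ad _ (offDiag h₁ h₂ z) (diagRight B₁ B₂ p) := fun p z => by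
    induction z with
    | zero => simp only [LinearMap.map_zero, LinearMap.zero_apply]
    | tmul a u => rw [bracket_inZ_inS₂, LinearMap.map_neg, toSp_inZ, ad_skew, ad_diagRight_offDiag]
    | add z z' h h' => simp only [LinearMap.map_add, LinearMap.add_apply, h, h']
  have hZZ : ∀ z w : V₁ ⊗[k] V₂, toSp h₁ h₂ (bracket h₁ h₂ (inZ B₁ B₂ z) (inZ B₁ B₂ w)) =
      ad _ (offDiag h₁ h₂ z) (offDiag h₁ h₂ w) := fun z w => by
    induction z with
    | zero => simp only [LinearMap.map_zero, LinearMap.zero_apply]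
    | add z z' h h' => simp only [LinearMap.map_add, LinearMap.add_apply, h, h']
    | tmul a u =>
      induction w with
      | zero => simp only [LinearMap.map_zero]
      | add w w' h h' => simp only [LinearMap.map_add, h, h']
      | tmul b v =>
        rw [bracket_inZ_inZ, LinearMap.map_add, LinearMap.map_smul, LinearMap.map_smul, toSp_inS₁, toSp_inS₂, ad_offDiag_offDiag]
  have hRL : ad _ (diagRight B₁ B₂ p) (diagLeft B₁ B₂ g) = 0 := by
    rw [ad_skew, ad_diagLeft_diagRight, neg_zero]
  simp only [LinearMap.map_add, LinearMap.add_apply, hSZ, hSZ', hZS, hZS', hZZ, bracket_inS₁_inS₁,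
    bracket_inS₂_inS₂, bracket_inS₁_inS₂, bracket_inS₂_inS₁, toSp_inS₁, toSp_inS₂, toSp_inZ,
    ad_diagLeft_diagLeft, ad_diagRight_diagRight, ad_diagLeft_diagRight, hRL, LinearMap.map_zero]

theorem eq_form_smul_sub {V : Type*} [AddCommGroup V] [Module k V] {B : LinearMap.BilinForm k V}
    {v : Module.Basis (Fin 2) k V} (hv : ∀ i j, B (v i) (v j) = (formT i j : k)) (a : V) :
    a = B a (v 1) • v 0 - B a (v 0) • v 1 := by
  have hsum : a = v.repr a 0 • v 0 + v.repr a 1 • v 1 := by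
    conv_lhs => rw [← v.sum_repr a, Fin.sum_univ_two]
  have e0 : B a (v 0) = -v.repr a 1 := by
    conv_lhs => rw [hsum]
    simp [hv, formT]
  have e1 : B a (v 1) = v.repr a 0 := by
    conv_lhs => rw [hsum]
    simp [hv, formT]
  rw [e0, e1, neg_smul, sub_neg_eq_add]
  exact hsum

/-- A tensor is recovered from the off-diagonal block that it defines. -/
theorem tensor_eq_offDiag {v₁ : Module.Basis (Fin 2) k V₁}
    (hv : ∀ i j, B₁ (v₁ i) (v₁ j) = (formT i j : k)) (h₁ : B₁.IsAlt) (h₂ : B₂.IsAlt)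
    (z : V₁ ⊗[k] V₂) :
    z = v₁ 0 ⊗ₜ (act (orthSum B₁ B₂) (offDiag h₁ h₂ z) (v₁ 1, 0)).2 -
      v₁ 1 ⊗ₜ (act (orthSum B₁ B₂) (offDiag h₁ h₂ z) (v₁ 0, 0)).2 := by
  induction z with
  | zero => simp
  | tmul a u =>
    conv_lhs => rw [eq_form_smul_sub hv a]
    rw [act_offDiag, act_offDiag, TensorProduct.tmul_smul, TensorProduct.tmul_smul,
      TensorProduct.smul_tmul', TensorProduct.smul_tmul', ← TensorProduct.sub_tmul]
  | add z z' h h' =>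
    conv_lhs => rw [h, h']
    simp only [map_add, LinearMap.add_apply, Prod.snd_add, TensorProduct.tmul_add]
    abel

theorem injOn_toSp {v₁ : Module.Basis (Fin 2) k V₁}
    (hv : ∀ i j, B₁ (v₁ i) (v₁ j) = (formT i j : k)) (h₁ : B₁.IsAlt) (h₂ : B₂.IsAlt)
    {X : Space B₁ B₂} (hX : X ∈ parity B₁ B₂ 0) (h : toSp h₁ h₂ X = 0) : X = 0 := by
  obtain ⟨⟨f, p⟩, x, y, z⟩ := X
  obtain ⟨rfl, rfl⟩ : x = 0 ∧ y = 0 := mem_parity_zero.1 hX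
  rw [toSp_apply] at h
  have hoff1 : ∀ (z : V₁ ⊗[k] V₂) c, (act (orthSum B₁ B₂) (offDiag h₁ h₂ z) (c, 0)).1 = 0 := by
    intro z c
    induction z with
    | zero => simp
    | tmul a u => simp [act_offDiag]
    | add z z' h h' => simp [h, h']
  have hoff2 : ∀ (z : V₁ ⊗[k] V₂) d, (act (orthSum B₁ B₂) (offDiag h₁ h₂ z) (0, d)).2 = 0 := by
    intro z c
    induction z with
    | zero => simp
    | tmul a u => simp [act_offDiag]
    | add z z' h h' => simp [h, h']
  have hx : ∀ x, act _ (diagLeft B₁ B₂ f) x + act _ (diagRight B₁ B₂ p) x +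
      act _ (offDiag h₁ h₂ z) x = 0 := fun x => by
    rw [← LinearMap.add_apply, ← LinearMap.add_apply, ← map_add, ← map_add]
    simp only at h
    rw [h, map_zero, LinearMap.zero_apply]
  have hf : f = 0 := sp_ext_apply fun c => by
    simpa [act_diagLeft, act_diagRight, hoff1] using congrArg Prod.fst (hx (c, 0))
  have hp : p = 0 := sp_ext_apply fun d => by
    simpa [act_diagLeft, act_diagRight, hoff2] using congrArg Prod.snd (hx (0, d))
  have hz : z = 0 := by
    have hc : ∀ c, (act _ (offDiag h₁ h₂ z) (c, 0)).2 = 0 := fun c => by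
      simpa [act_diagLeft, act_diagRight] using congrArg Prod.snd (hx (c, 0))
    rw [tensor_eq_offDiag hv h₁ h₂ z, hc, hc]
    simp
  rw [hf, hp, hz]
  rfl

/-- The preimage is read off from the blocks of `F`: its diagonal blocks, and the tensor that
encodes its block from V₁ to V₂. Only V₁ needs a symplectic basis. -/
theorem surjOn_toSp {v₁ : Module.Basis (Fin 2) k V₁}
    (hv : ∀ i j, B₁ (v₁ i) (v₁ j) = (formT i j : k)) (h₁ : B₁.IsAlt) (h₂ : B₂.IsAlt)
    (F : Sp (orthSum B₁ B₂)) : ∃ X ∈ parity B₁ B₂ 0, toSp h₁ h₂ X = F := by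
  have hF := form_act _ F
  let f : Sp B₁ := ⟨LinearMap.fst k V₁ V₂ ∘ₗ act _ F ∘ₗ LinearMap.inl k V₁ V₂, by
    refine (LinearMap.mem_skewAdjointSubmodule _).mpr fun x y => ?_
    simpa [orthSum_apply] using hF (x, 0) (y, 0)⟩
  let p : Sp B₂ := ⟨LinearMap.snd k V₁ V₂ ∘ₗ act _ F ∘ₗ LinearMap.inr k V₁ V₂, by
    refine (LinearMap.mem_skewAdjointSubmodule _).mpr fun x y => ?_
    simpa [orthSum_apply] using hF (0, x) (0, y)⟩
  -- The formula of `tensor_eq_offDiag`, with `F` in place of the off-diagonal map.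
  let z : V₁ ⊗[k] V₂ := v₁ 0 ⊗ₜ (act _ F (v₁ 1, 0)).2 - v₁ 1 ⊗ₜ (act _ F (v₁ 0, 0)).2
  have hz21 : ∀ c, (act _ F (c, 0)).2 = B₁ (v₁ 0) c • (act _ F (v₁ 1, 0)).2 -
      B₁ (v₁ 1) c • (act _ F (v₁ 0, 0)).2 := fun c => by
    have hc : ((c, 0) : V₁ × V₂) = B₁ c (v₁ 1) • (v₁ 0, 0) - B₁ c (v₁ 0) • (v₁ 1, 0) := by
      ext
      · exact eq_form_smul_sub hv c
      · simp
    rw [hc, ← LinearMap.IsAlt.neg h₁ c (v₁ 0), ← LinearMap.IsAlt.neg h₁ c (v₁ 1)]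
    simp only [map_sub, map_smul, Prod.snd_sub, Prod.smul_snd]
    module
  -- Skew-adjointness determines the block from V₂ to V₁ by the other one.
  have hz12 : ∀ d, (act _ F (0, d)).1 = B₂ (act _ F (v₁ 1, 0)).2 d • v₁ 0 -
      B₂ (act _ F (v₁ 0, 0)).2 d • v₁ 1 := fun d => by
    have e0 := hF (v₁ 0, 0) (0, d)
    have e1 := hF (v₁ 1, 0) (0, d)
    simp only [orthSum_apply, map_zero, LinearMap.zero_apply, add_zero, zero_add,
      LinearMap.IsAlt.neg h₁] at e0 e1
    rw [e0, e1]
    exact eq_form_smul_sub hv _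
  refine ⟨((f, p), 0, 0, z), mem_parity_zero.2 ⟨rfl, rfl⟩, ?_⟩
  rw [toSp_apply]
  refine sp_ext_apply fun ⟨c, d⟩ => ?_
  have hcd : ((c, d) : V₁ × V₂) = (c, 0) + (0, d) := by simp
  simp only [map_add, LinearMap.add_apply, act_diagLeft, act_diagRight]
  rw [map_sub, map_sub, LinearMap.sub_apply, act_offDiag, act_offDiag]
  conv_rhs => rw [hcd, map_add]
  ext
  · simp only [Prod.fst_add, Prod.fst_sub]
    rw [add_zero, hz12 d]
    rfl
  · simp only [Prod.snd_add, Prod.snd_sub]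
    rw [zero_add, add_comm, hz21 c]
    rfl

/-- The even part of the model is `𝔰𝔭(V₁ ⊥ V₂)`. -/
def evenEquiv {v₁ : Module.Basis (Fin 2) k V₁}
    (hv : ∀ i j, B₁ (v₁ i) (v₁ j) = (formT i j : k)) (h₁ : B₁.IsAlt) (h₂ : B₂.IsAlt) :
    parity B₁ B₂ 0 ≃ₗ[k] Sp (orthSum B₁ B₂) :=
  LinearEquiv.ofBijective (toSp h₁ h₂ ∘ₗ (parity B₁ B₂ 0).subtype)
    ⟨(injective_iff_map_eq_zero _).2 fun X hX => Subtype.ext (injOn_toSp hv h₁ h₂ X.2 hX),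
      fun F => by
        obtain ⟨X, hX, h⟩ := surjOn_toSp hv h₁ h₂ F
        exact ⟨⟨X, hX⟩, h⟩⟩

end EvenPart

/-! ### Passage to 4 × 4 symplectic matrices -/

section Matrices

variable {k : Type*} [Field k]

/-- Being skew-adjoint means that (f, -f) is an adjoint pair, a condition that passes to matrices
once the form has Gram matrix `J`. -/
theorem toMatrix_mem_skewAdjoint_iff {V n : Type*} [AddCommGroup V] [Module k V] [Fintype n]
    [DecidableEq n] {B : LinearMap.BilinForm k V} {J : Matrix n n k} (w : Module.Basis n k V)
    (hw : ∀ i j, B (w i) (w j) = J i j) (f : Module.End k V) :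
    LinearMap.toMatrix w w f ∈ skewAdjointMatricesLieSubalgebra J ↔
      f ∈ skewAdjointLieSubalgebra B := by
  have hJ : LinearMap.toMatrix₂ w w B = J := by
    ext i j
    rw [LinearMap.toMatrix₂_apply, hw]
  have hB : B = Matrix.toLinearMap₂ w w J := by
    rw [← hJ, Matrix.toLinearMap₂_toMatrix₂]
  have h := isAdjointPair_toLinearMap₂ (b₁ := w) (b₂ := w) J J (LinearMap.toMatrix w w f)
    (-LinearMap.toMatrix w w f)
  rw [← hB, map_neg, Matrix.toLin_toMatrix] at h
  exact (mem_skewAdjointMatricesSubmodule J _).trans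
    (h.symm.trans (LinearMap.mem_skewAdjointSubmodule f).symm)

/-- A basis identifies the skew-adjoint endomorphisms with the skew-adjoint matrices. -/
def skewAdjointEquivMatrix {V n : Type*} [AddCommGroup V] [Module k V] [Fintype n]
    [DecidableEq n] {B : LinearMap.BilinForm k V} {J : Matrix n n k} (w : Module.Basis n k V)
    (hw : ∀ i j, B (w i) (w j) = J i j) :
    skewAdjointLieSubalgebra B ≃ₗ[k] skewAdjointMatricesLieSubalgebra J :=
  (LinearMap.toMatrix w w).submoduleMap (skewAdjointLieSubalgebra B).toSubmodule |>.trans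
    (LinearEquiv.ofEq _ _ (by
      ext M
      rw [Submodule.mem_map_equiv]
      change _ ↔ M ∈ skewAdjointMatricesLieSubalgebra J
      rw [← (LinearMap.toMatrix w w).apply_symm_apply M, toMatrix_mem_skewAdjoint_iff w hw]
      simp))

theorem skewAdjointEquivMatrix_lie {V n : Type*} [AddCommGroup V] [Module k V] [Fintype n]
    [DecidableEq n] {B : LinearMap.BilinForm k V} {J : Matrix n n k} (w : Module.Basis n k V)
    (hw : ∀ i j, B (w i) (w j) = J i j) (f g : skewAdjointLieSubalgebra B) :
    skewAdjointEquivMatrix w hw ⁅f, g⁆ =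
      ⁅skewAdjointEquivMatrix w hw f, skewAdjointEquivMatrix w hw g⁆ := by
  refine Subtype.ext ?_
  change LinearMap.toMatrix w w ((f : Module.End k V) * g - g * f) =
    LinearMap.toMatrix w w f * LinearMap.toMatrix w w g -
      LinearMap.toMatrix w w g * LinearMap.toMatrix w w f
  rw [map_sub, LinearMap.toMatrix_mul, LinearMap.toMatrix_mul]

theorem exists_basis_orthSum {V₁ V₂ : Type*} [AddCommGroup V₁] [Module k V₁]
    [AddCommGroup V₂] [Module k V₂] {B₁ : LinearMap.BilinForm k V₁} {B₂ : LinearMap.BilinForm k V₂}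
    {v₁ : Module.Basis (Fin 2) k V₁} {v₂ : Module.Basis (Fin 2) k V₂}
    (hv₁ : ∀ i j, B₁ (v₁ i) (v₁ j) = (formT i j : k))
    (hv₂ : ∀ i j, B₂ (v₂ i) (v₂ j) = (formT i j : k)) :
    ∃ w : Module.Basis (Fin 2 ⊕ Fin 2) k (V₁ × V₂),
      ∀ i j, orthSum B₁ B₂ (w i) (w j) = Matrix.J (Fin 2) k i j := by
  -- The second vectors of the two planes come first and the first vectors last, because the upper
  -- right block of `Matrix.J` is -1 and ⟨v₁|v₀⟩ = -1.
  let e : Fin 2 ⊕ Fin 2 ≃ Fin 2 ⊕ Fin 2 :=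
    { toFun := Sum.elim ![.inr 0, .inl 0] ![.inr 1, .inl 1]
      invFun := Sum.elim ![.inl 1, .inr 1] ![.inl 0, .inr 0]
      left_inv := by decide
      right_inv := by decide }
  refine ⟨(v₁.prod v₂).reindex e, fun i j => ?_⟩
  rw [Module.Basis.reindex_apply, Module.Basis.reindex_apply]
  rcases i with i | i <;> rcases j with j | j <;> fin_cases i <;> fin_cases j <;>
    simp [e, Matrix.J, orthSum_apply, hv₁, hv₂, formT]

end Matrices

end Model


end

theorem theorem6p1 {k : Type*} [Field k] [CharP k 5]
    {V₁ V₂ : Type*} [AddCommGroup V₁] [Module k V₁] [AddCommGroup V₂] [Module k V₂]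
    (hV₁ : Module.finrank k V₁ = 2) (hV₂ : Module.finrank k V₂ = 2)
    (B₁ : LinearMap.BilinForm k V₁) (B₂ : LinearMap.BilinForm k V₂)
    (h₁ : B₁.IsAlt) (h₂ : B₂.IsAlt) (hB₁ : B₁ ≠ 0) (hB₂ : B₂ ≠ 0) :
    -- the product makes the model a Lie superalgebra
    IsLieSuperalgebra (Model.parity B₁ B₂) (Model.bracket h₁ h₂) ∧
    -- its even part is a Lie algebra isomorphic to `𝔰𝔭(V₁ ⊥ V₂)`
    (∃ φ : Model.parity B₁ B₂ 0 ≃ₗ[k] skewAdjointLieSubalgebra (Model.orthSum B₁ B₂),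
      ∀ x y z : Model.parity B₁ B₂ 0, (z : Model.Space B₁ B₂) = Model.bracket h₁ h₂ x y →
        φ z = ⁅φ x, φ y⁆) ∧
    -- and to `𝔰𝔭₄`
    (∃ ψ : Model.parity B₁ B₂ 0 ≃ₗ[k] LieAlgebra.Symplectic.sp (Fin 2) k,
      ∀ x y z : Model.parity B₁ B₂ 0, (z : Model.Space B₁ B₂) = Model.bracket h₁ h₂ x y →
        ψ z = ⁅ψ x, ψ y⁆) ∧
    -- and it is isomorphic to `𝔟𝔯(2;5)`
    SuperalgebraIso (Model.parity B₁ B₂) (Model.bracket h₁ h₂)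
      (br25Parity k) (br25Bracket k) := by
  obtain ⟨v₁, s₁, H₁⟩ := Model.exists_isStandard hV₁ B₁ h₁ hB₁
  obtain ⟨v₂, s₂, H₂⟩ := Model.exists_isStandard hV₂ B₂ h₂ hB₂
  have hP : Model.parity B₁ B₂ = sector (Model.spaceBasis v₁ s₁ v₂ s₂) Br25Table.par :=
    funext (Model.parity_eq_sector v₁ s₁ v₂ s₂)
  have hT := Model.bracket_spaceBasis H₁ H₂ h₁ h₂
  have hφ : ∀ x y z : Model.parity B₁ B₂ 0, (z : Model.Space B₁ B₂) = Model.bracket h₁ h₂ x y →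
      Model.evenEquiv H₁.form h₁ h₂ z =
        ⁅Model.evenEquiv H₁.form h₁ h₂ x, Model.evenEquiv H₁.form h₁ h₂ y⁆ := fun x y z h => by
    change Model.toSp h₁ h₂ z = Model.ad _ (Model.toSp h₁ h₂ x) (Model.toSp h₁ h₂ y)
    rw [h, Model.toSp_bracket h₁ h₂ x.2 y.2]
  obtain ⟨w, hw⟩ := Model.exists_basis_orthSum H₁.form H₂.form
  refine ⟨?_, ⟨_, hφ⟩, ⟨(Model.evenEquiv H₁.form h₁ h₂).trans (Model.skewAdjointEquivMatrix w hw),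
    fun x y z h => ?_⟩, ?_⟩
  · rw [hP]
    exact Br25Table.isLieSuperalgebra_of_table hT
  · change Model.skewAdjointEquivMatrix w hw (Model.evenEquiv H₁.form h₁ h₂ z) =
      ⁅Model.skewAdjointEquivMatrix w hw (Model.evenEquiv H₁.form h₁ h₂ x),
        Model.skewAdjointEquivMatrix w hw (Model.evenEquiv H₁.form h₁ h₂ y)⁆
    rw [hφ x y z h]
    exact Model.skewAdjointEquivMatrix_lie w hw _ _
  · rw [hP]
    exact Br25Table.superalgebraIso_of_table hT
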